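/- Let $\phi(z)=\sum_{n\ge 1}\phi_n z^n$ be a formal power series with real coefficients (so $\phi(0)=0$) and put $f(z)=z\bigl(1-\phi(z)\bigr)=\sum_{n\ge1}f_nz^n$. For $0<q<1$ let $g(z)=\sum_{n\ge 1}g_n z^n$ (with $g_n=g_n(q)$) be the formal power series without constant term that satisfies $$\sum_{n\ge 1} f_n\, g(z)g(z/q)\cdots g(z/q^{n-1})=z .$$ Write $\tilde\phi(z)=\phi(-z)$ and $\tilde\phi_n=(-1)^n\phi_n$. **(A)** Assume that (i) $\tilde\phi_i\ge 0$ for all $i\ge 1$; (ii) $\zeta=\min\{x>0:\tilde\phi(x)=1\}$ exists; (iii) for every integer $j\ge 0$, $\lim_{n\to\infty}\tilde\phi_{j+n}/\tilde\phi_n$ exists in $[0,\infty)$ (quotients with $\tilde\phi_n=0$ being read as $0$); (iv) the sequence $c_n=[z^n]\frac{1}{1-\tilde\phi(\zeta z)}$ is regularly varying with index $\rho-1\in(-1,0]$, that is, $\lim_{t\to\infty}c_{\lfloor\lambda t\rfloor}/c_{\lfloor t\rfloor}=\lambda^{\rho-1}$ for every $\lambda>0$. For $n\ge 1$ and $0<q<1$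 put $$a_n(q)=\zeta^n n\Bigl(1-\tilde\phi\bigl(\zeta(1-\tfrac1n)\bigr)\Bigr)q^{\binom n2}(-1)^{n+1}g_n,\qquad L(q)=\frac{\zeta}{\Gamma(\rho)\prod_{j\ge 1}\bigl(1-\tilde\phi(\zeta q^j)\bigr)} .$$ Then each $a_n$ is a polynomial in $q$, the product converges and $L$ is given on $(0,1)$ by a convergent power series in $q$, and $a_n\to L$ in the following three senses: $\liminf_{n\to\infty}a_n(q)=L(q)$ for every $q\in(0,1)$; for every $q\in(0,1)$ and $\delta>0$, $\lim_{n\to\infty}\frac1n\#\{1\le i\le n:|a_i(q)-L(q)|\ge\delta\}=0$; and $\lim_{n\to\infty}[q^j]a_n=[q^j]L$ for every integer $j\ge0$. **(B)** Assume that $\tilde\phi_n\ge0$ for all $n$, that $\limsup_{n\to\infty}\frac{\log\tilde\phi_n}{n\log n}<-2$ (with $\log 0=-\infty$), and that $\tilde\phi(z)=1-(1-z/\zeta)\theta(z)$ for all $z\in\mathbb C$ (in particular $\tilde\phi(\zeta)=1$), where $\zeta>0$ and $\theta$ is a meromorphic function without zeros in the closed disk $|z|\le\zeta$. Then for every $q\in(0,1)$,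 as $n\to\infty$, $$(-1)^{n+1}g_n\sim\frac{1}{q^{\binom n2}\,\zeta^n\,\tilde\phi'(\zeta)\,\prod_{j\ge1}(1-q^j)\,\prod_{j\ge 1}\theta(\zeta q^j)},$$ both infinite products being convergent. -/

import Mathlib

open Filter Topology Asymptotics
open PowerSeries (coeff constantCoeff rescale)

namespace QLagrange

/-- The value at `x` of the (real) power series `p`, meant where the series converges. -/
noncomputable def psEval (p : PowerSeries ℝ) (x : ℝ) : ℝ :=
  ∑' n : ℕ, coeff n p * x ^ n

/-- `g` is the right inverse of `f` (for the parameter `q`): `g` has no constant term and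
`∑_{n ≥ 1} f_n g(z) g(z/q) ⋯ g(z/q^(n-1)) = z` as formal power series.
Here `rescale c g` is `g(c z)`. As `g` has no constant term, the `n`-th product is divisible by
`z ^ n`, so that exactly the terms `1 ≤ n ≤ m` can contribute to the coefficient of `z ^ m`. -/
def IsRightInverse (q : ℝ) (f g : PowerSeries ℝ) : Prop :=
  constantCoeff g = 0 ∧
    ∀ m : ℕ, ∑ n ∈ Finset.Icc 1 m,
      coeff n f * coeff m (∏ k ∈ Finset.range n, rescale ((1 / q) ^ k) g) =
        coeff m (PowerSeries.X : PowerSeries ℝ)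

/-- Regular variation at infinity, with index `r`. -/
def RegularlyVarying (h : ℝ → ℝ) (r : ℝ) : Prop :=
  ∀ l : ℝ, 0 < l → Tendsto (fun t : ℝ => h (l * t) / h t) atTop (𝓝 (l ^ r))

/-- A sequence is regularly varying if the function that is constant on the intervals
`[n, n + 1)` with the values of the sequence is so. -/
def RegularlyVaryingSeq (c : ℕ → ℝ) (r : ℝ) : Prop :=
  RegularlyVarying (fun t : ℝ => c ⌊t⌋₊) r

/-! ### Three modes of convergence of polynomials `a_n(q)` to a power series `L(q)` on a set -/

/-- Convergence in limit infimum (taken in the extended reals). -/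
def ConvergesLiminf (a : ℕ → Polynomial ℝ) (L : PowerSeries ℝ) (A : Set ℝ) : Prop :=
  ∀ q ∈ A, liminf (fun n : ℕ => (((a n).eval q : ℝ) : EReal)) atTop = ((psEval L q : ℝ) : EReal)

open Classical in
/-- Convergence except on a set of integers of density `0`. -/
def ConvergesOffDensityZero (a : ℕ → Polynomial ℝ) (L : PowerSeries ℝ) (A : Set ℝ) : Prop :=
  ∀ δ : ℝ, 0 < δ → ∀ q ∈ A,
    Tendsto (fun n : ℕ => (1 / (n : ℝ)) *
      ∑ i ∈ Finset.Icc 1 n, if δ ≤ |(a i).eval q - psEval L q| then (1 : ℝ) else 0)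
      atTop (𝓝 0)

/-- Coefficientwise convergence. -/
def ConvergesCoeffwise (a : ℕ → Polynomial ℝ) (L : PowerSeries ℝ) : Prop :=
  ∀ j : ℕ, Tendsto (fun n : ℕ => (a n).coeff j) atTop (𝓝 (coeff j L))

/-! ### The regularly varying case -/

/-- The assumptions on the power series `φ`, with `ζ` and `ρ` the numbers they introduce. -/
structure RegVarAssumptions (φ : PowerSeries ℝ) (ζ ρ : ℝ) : Prop where
  nonneg : ∀ i : ℕ, 1 ≤ i → 0 ≤ coeff i φ
  /-- `ζ = min {x > 0 : φ(x) = 1}` -/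
  zeta_isLeast : IsLeast {x : ℝ | 0 < x ∧ HasSum (fun n : ℕ => coeff n φ * x ^ n) 1} ζ
  ratio : ∀ j : ℕ, ∃ l : ℝ, 0 ≤ l ∧
    Tendsto (fun n : ℕ => coeff (j + n) φ / coeff n φ) atTop (𝓝 l)
  rho_mem : ρ - 1 ∈ Set.Ioc (-1 : ℝ) 0
  /-- `[z^n] 1 / (1 - φ(ζ z))` is regularly varying of index `ρ - 1` -/
  regVar : RegularlyVaryingSeq (fun n : ℕ => coeff n (1 - rescale ζ φ)⁻¹) (ρ - 1)

/-- For `q` in `(0, 1)`, the quantities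
`ζ^n n (1 - φ(ζ(1 - 1/n))) q^(n choose 2) γ_n(q)`, `n ≥ 1`, are polynomials `a_n(q)` and
`ζ / (Γ(ρ) ∏_{j ≥ 1} (1 - φ(ζ q^j)))` is a (convergent) power series `L(q)`, both of them
being determined by their values on `(0, 1)`, and `a_n` converges to `L` in the three modes. -/
def RegVarConclusion (φ : PowerSeries ℝ) (ζ ρ : ℝ) (γ : ℝ → ℕ → ℝ) : Prop :=
  ∃ (a : ℕ → Polynomial ℝ) (L : PowerSeries ℝ),
    (∀ n : ℕ, 1 ≤ n → ∀ q ∈ Set.Ioo (0 : ℝ) 1,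
      (a n).eval q =
        ζ ^ n * n * (1 - psEval φ (ζ * (1 - 1 / (n : ℝ)))) * q ^ (n.choose 2) * γ q n) ∧
    (∀ q ∈ Set.Ioo (0 : ℝ) 1,
      Multipliable (fun j : ℕ => 1 - psEval φ (ζ * q ^ (j + 1))) ∧
      HasSum (fun j : ℕ => coeff j L * q ^ j)
        (ζ / (Real.Gamma ρ * ∏' j : ℕ, (1 - psEval φ (ζ * q ^ (j + 1)))))) ∧
    ConvergesLiminf a L (Set.Ioo 0 1) ∧
    ConvergesOffDensityZero a L (Set.Ioo 0 1) ∧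
    ConvergesCoeffwise a L

/-! ### The case of superexponentially small coefficients -/

/-- The assumptions on the power series `φ`, with `ζ` and `θ` the number and the function that
they introduce. In `limsup` one has `log 0 = -∞`, which `ENNReal.log` provides. -/
structure SuperexpAssumptions (φ : PowerSeries ℝ) (ζ : ℝ) (θ : ℂ → ℂ) : Prop where
  nonneg : ∀ n : ℕ, 0 ≤ coeff n φ
  decay : limsup (fun n : ℕ => ENNReal.log (ENNReal.ofReal (coeff n φ)) /
    (((n : ℝ) * Real.log n : ℝ) : EReal)) atTop < ((-2 : ℝ) : EReal)
  zeta_pos : 0 < ζ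
  meromorphic : MeromorphicOn θ Set.univ
  /-- `φ(z) = 1 - (1 - z/ζ) θ(z)`; at `z = ζ` this says `φ(ζ) = 1` -/
  factor : ∀ z : ℂ, HasSum (fun n : ℕ => ((coeff n φ : ℝ) : ℂ) * z ^ n)
    (1 - (1 - z / (ζ : ℂ)) * θ z)
  no_root : ∀ z : ℂ, ‖z‖ ≤ ζ → θ z ≠ 0

/-- `γ_n ∼ 1 / (q^(n choose 2) ζ^n φ'(ζ) (q;q)_∞ ∏_{j ≥ 1} θ(ζ q^j))` as `n → ∞`, the infinite
products being convergent. -/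
def SuperexpConclusion (φ : PowerSeries ℝ) (ζ : ℝ) (θ : ℂ → ℂ) (q : ℝ) (γ : ℕ → ℝ) : Prop :=
  Multipliable (fun j : ℕ => 1 - q ^ (j + 1)) ∧
  Multipliable (fun j : ℕ => θ ((ζ * q ^ (j + 1) : ℝ) : ℂ)) ∧
  (fun n : ℕ => ((γ n : ℝ) : ℂ)) ~[atTop] (fun n : ℕ =>
    1 / (((q ^ (n.choose 2) * ζ ^ n * deriv (psEval φ) ζ * ∏' j : ℕ, (1 - q ^ (j + 1)) : ℝ) : ℂ) *
      ∏' j : ℕ, θ ((ζ * q ^ (j + 1) : ℝ) : ℂ)))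

end QLagrange

namespace QLagrange

/-! Replacing φ(z), g(z) by φ(-z), -g(-z) preserves the equation, so one may take φ to have
nonnegative coefficients. The equation then reads g = z + ∑ φ_n g(z)⋯g(z/q^n), a recursion with
nonnegative terms; it makes q^(n choose 2) g_n a polynomial in q with nonnegative coefficients.

The nonlinear equation becomes linear through the series H with H(0) = 1 and z H(z/q) = g(z) H(z):
times H, the product g(z)⋯g(z/q^(n-1)) telescopes to a multiple of z^n H(z/q^n). Weighting H_m by
ζ^m q^((m+1) choose 2) gives a series B with (1 - φ(ζz)) B(z/q) = B(z), that is, B(z) = ∏_{j ≥ 1}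
1/(1 - φ(ζ q^j z)).

Let c_n be the coefficients of 1/(1 - φ(ζz)), a renewal sequence. The coefficients of B(z/q) =
B(z)/(1 - φ(ζz)) are the convolution of those of B, which are O(q^n), with c. If c_n ∼ c_{n+1}, they
are asymptotic to B(1) c_n. The defining relation of H expresses them as u_n = ζ^n q^((n+1) choose
2) g_{n+1} plus terms of total size O(n q^n), negligible because c decays subexponentially. Hence
u_n ∼ c_n / ∏ (1 - φ(ζ q^j)) (`IsRightInverse.tendsto_div`).

In (A), regular variation gives c_n ∼ c_{n+1} by Potter's bounds, and an Abelian theorem turns c_n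
into 1/(Γ(ρ) n (1 - φ(ζ(1 - 1/n)))). So a_n(q) converges in the ordinary sense at every q in (0, 1),
which implies the first two modes; nonnegativity of the coefficients yields the power series L and
coefficientwise convergence. In (B), (1 - z)/(1 - φ(ζz)) is analytic beyond the closed unit disk, so
c_n tends to 1/(ζ φ'(ζ)). -/

theorem choose_two_succ_add (i j : ℕ) :
    (i + j + 1).choose 2 = (i + 1).choose 2 + (j + 1).choose 2 + i * j := by
  have h (n : ℕ) : (n + 1).choose 2 = n.choose 2 + n := by
    rw [Nat.choose_succ_succ' n 1, Nat.choose_one_right, add_comm]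
  induction j with
  | zero => simp
  | succ j ih =>
    rw [← add_assoc, h (i + j + 1), ih, h (j + 1)]; ring

theorem choose_two_add (a b : ℕ) :
    (a + b).choose 2 = a.choose 2 + b.choose 2 + a * b := by
  have h (n : ℕ) : (n + 1).choose 2 = n.choose 2 + n := by
    rw [Nat.choose_succ_succ' n 1, Nat.choose_one_right, add_comm]
  induction b with
  | zero => simp
  | succ b ih => rw [← add_assoc, h, ih, h b]; ring

/-! ### Sign change and elementary facts about the right inverse -/

/-- Changing the sign of the variable. -/
theorem IsRightInverse.neg {q : ℝ} {φ g : PowerSeries ℝ}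
    (h : IsRightInverse q (PowerSeries.X * (1 - φ)) g) :
    IsRightInverse q (PowerSeries.X * (1 - rescale (-1 : ℝ) φ)) (-(rescale (-1 : ℝ) g)) := by
  obtain ⟨h0, h1⟩ := h
  refine ⟨?_, fun m => ?_⟩
  · rw [map_neg, ← PowerSeries.coeff_zero_eq_constantCoeff_apply, PowerSeries.coeff_rescale,
      PowerSeries.coeff_zero_eq_constantCoeff_apply, h0, mul_zero, neg_zero]
  · have hf : PowerSeries.X * (1 - rescale (-1 : ℝ) φ)
        = -(rescale (-1 : ℝ) (PowerSeries.X * (1 - φ))) := by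
      rw [map_mul, map_sub, map_one, PowerSeries.rescale_X]
      simp
    have hp (n : ℕ) : ∏ k ∈ Finset.range n, rescale ((1 / q) ^ k) (-(rescale (-1 : ℝ) g))
        = (-1) ^ n * rescale (-1 : ℝ) (∏ k ∈ Finset.range n, rescale ((1 / q) ^ k) g) := by
      rw [map_prod]
      induction n with
      | zero => simp
      | succ n ih =>
        rw [Finset.prod_range_succ, ih, Finset.prod_range_succ, map_neg,
          PowerSeries.rescale_rescale, PowerSeries.rescale_rescale, mul_comm (-1 : ℝ)]
        ring
    have hc (n : ℕ) (s : PowerSeries ℝ) : coeff m ((-1) ^ n * s) = (-1) ^ n * coeff m s := by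
      have : ((-1 : PowerSeries ℝ)) ^ n = PowerSeries.C ((-1 : ℝ) ^ n) := by simp
      rw [this, PowerSeries.coeff_C_mul]
    have h2 := h1 m
    -- The sign (-1)^n from the n factors of the product cancels the one from the coefficient of f,
    -- so the remaining sign -(-1)^m does not depend on n. It is 1 for m = 1, the only m at which
    -- the right side is nonzero.
    have : ∀ n, coeff n (PowerSeries.X * (1 - rescale (-1 : ℝ) φ)) *
        coeff m (∏ k ∈ Finset.range n, rescale ((1 / q) ^ k) (-(rescale (-1 : ℝ) g)))
        = -(-1) ^ m * (coeff n (PowerSeries.X * (1 - φ)) *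
          coeff m (∏ k ∈ Finset.range n, rescale ((1 / q) ^ k) g)) := by
      intro n
      rw [hf, hp, hc, map_neg, PowerSeries.coeff_rescale, PowerSeries.coeff_rescale]
      have : ((-1 : ℝ) ^ n) * (-1) ^ n = 1 := by rw [← mul_pow]; simp
      linear_combination (-(-1) ^ m * (coeff n (PowerSeries.X * (1 - φ)) *
          coeff m (∏ k ∈ Finset.range n, rescale ((1 / q) ^ k) g))) * this
    rw [Finset.sum_congr rfl fun n _ => this n, ← Finset.mul_sum, h2, PowerSeries.coeff_X]
    split_ifs with hm <;> simp [hm]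

theorem IsRightInverse.coeff_one {q : ℝ} {φ g : PowerSeries ℝ} (hφ : constantCoeff φ = 0)
    (h : IsRightInverse q (PowerSeries.X * (1 - φ)) g) : coeff 1 g = 1 := by
  have := h.2 1
  simpa [hφ, PowerSeries.coeff_succ_X_mul] using this

theorem coeff_prod_rescale_eq_zero {g : PowerSeries ℝ} (hg : constantCoeff g = 0) (r : ℝ)
    {n m : ℕ} (hm : m < n) : coeff m (∏ k ∈ Finset.range n, rescale (r ^ k) g) = 0 := by
  have hd : (PowerSeries.X : PowerSeries ℝ) ^ n ∣ ∏ k ∈ Finset.range n, rescale (r ^ k) g := by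
    have := Finset.prod_dvd_prod_of_dvd (s := Finset.range n)
      (fun _ : ℕ => (PowerSeries.X : PowerSeries ℝ)) (fun k => rescale (r ^ k) g) (fun k _ => by
        rw [PowerSeries.X_dvd_iff, ← PowerSeries.coeff_zero_eq_constantCoeff_apply,
          PowerSeries.coeff_rescale, PowerSeries.coeff_zero_eq_constantCoeff_apply, hg, mul_zero])
    simpa using this
  exact (PowerSeries.X_pow_dvd_iff.1 hd) m hm

/-! ### Polynomials with nonnegative coefficients -/

/-- `F` agrees on `(0, 1)` with a polynomial that has nonnegative coefficients. -/
def IsNonnegPoly (F : ℝ → ℝ) : Prop :=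
  ∃ P : Polynomial ℝ, (∀ j, 0 ≤ P.coeff j) ∧ ∀ q ∈ Set.Ioo (0 : ℝ) 1, P.eval q = F q

namespace IsNonnegPoly

theorem congr {F G : ℝ → ℝ} (hF : IsNonnegPoly F) (h : ∀ q ∈ Set.Ioo (0 : ℝ) 1, F q = G q) :
    IsNonnegPoly G := by
  obtain ⟨P, h0, h1⟩ := hF
  exact ⟨P, h0, fun q hq => (h1 q hq).trans (h q hq)⟩

theorem const {a : ℝ} (ha : 0 ≤ a) : IsNonnegPoly fun _ => a :=
  ⟨Polynomial.C a, fun j => by rw [Polynomial.coeff_C]; split_ifs <;> simp [ha],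
    fun q _ => by simp⟩

theorem pow (k : ℕ) : IsNonnegPoly fun q => q ^ k :=
  ⟨Polynomial.X ^ k, fun j => by rw [Polynomial.coeff_X_pow]; split_ifs <;> simp,
    fun q _ => by simp⟩

theorem add {F G : ℝ → ℝ} (hF : IsNonnegPoly F) (hG : IsNonnegPoly G) :
    IsNonnegPoly fun q => F q + G q := by
  obtain ⟨P, h0, h1⟩ := hF
  obtain ⟨Q, k0, k1⟩ := hG
  exact ⟨P + Q, fun j => by rw [Polynomial.coeff_add]; exact add_nonneg (h0 j) (k0 j),
    fun q hq => by rw [Polynomial.eval_add, h1 q hq, k1 q hq]⟩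

theorem mul {F G : ℝ → ℝ} (hF : IsNonnegPoly F) (hG : IsNonnegPoly G) :
    IsNonnegPoly fun q => F q * G q := by
  obtain ⟨P, h0, h1⟩ := hF
  obtain ⟨Q, k0, k1⟩ := hG
  exact ⟨P * Q, fun j => by
      rw [Polynomial.coeff_mul]; exact Finset.sum_nonneg fun x _ => mul_nonneg (h0 _) (k0 _),
    fun q hq => by rw [Polynomial.eval_mul, h1 q hq, k1 q hq]⟩

theorem sum {ι : Type*} (s : Finset ι) {F : ι → ℝ → ℝ} (hF : ∀ i ∈ s, IsNonnegPoly (F i)) :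
    IsNonnegPoly fun q => ∑ i ∈ s, F i q := by
  classical
  induction s using Finset.induction_on with
  | empty => simpa using const le_rfl
  | insert a s ha ih =>
    simp only [Finset.sum_insert ha]
    exact (hF a (by simp)).add (ih fun i hi => hF i (by simp [hi]))

theorem nonneg {F : ℝ → ℝ} (hF : IsNonnegPoly F) {q : ℝ} (hq : q ∈ Set.Ioo (0 : ℝ) 1) :
    0 ≤ F q := by
  obtain ⟨P, h0, h1⟩ := hF
  rw [← h1 q hq, Polynomial.eval_eq_sum]
  exact Finset.sum_nonneg fun i _ => mul_nonneg (h0 i) (pow_nonneg hq.1.le i)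

end IsNonnegPoly

/-- Splitting off the last factor with m = a + b, the exponent (m choose 2) leaves ab beyond those
of the two parts, and the rescaling costs q^(-nb); what remains is q^((a - n)b), with a ≥ n because
n factors have order at least n. In the condition on m, each of the other n - 1 factors uses at
least one degree, so only g_a with a < M occur. -/
theorem isNonnegPoly_coeff_prod {g : ℝ → PowerSeries ℝ}
    (hg0 : ∀ q ∈ Set.Ioo (0 : ℝ) 1, constantCoeff (g q) = 0) {M : ℕ}
    (hM : ∀ a < M, IsNonnegPoly fun q => q ^ (a.choose 2) * coeff a (g q)) (n : ℕ) :
    ∀ m, m + 1 < M + n → IsNonnegPoly fun q => q ^ (m.choose 2) *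
      coeff m (∏ k ∈ Finset.range n, rescale ((1 / q) ^ k) (g q)) := by
  induction n with
  | zero =>
    intro m _
    simp only [Finset.range_zero, Finset.prod_empty, PowerSeries.coeff_one]
    refine (IsNonnegPoly.pow _).mul (IsNonnegPoly.const ?_)
    split_ifs <;> simp
  | succ n ih =>
    intro m hm
    have key : IsNonnegPoly fun q => ∑ x ∈ Finset.HasAntidiagonal.antidiagonal m,
        -- The excluded terms vanish anyway. Excluding them keeps the indices in the range of the
        -- hypotheses and makes the truncated difference `x.1 - n` a true one.
        if x.1 < n ∨ x.2 = 0 then 0 else q ^ ((x.1 - n) * x.2) *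
          ((q ^ (x.1.choose 2) *
            coeff x.1 (∏ k ∈ Finset.range n, rescale ((1 / q) ^ k) (g q))) *
          (q ^ (x.2.choose 2) * coeff x.2 (g q))) := by
      refine IsNonnegPoly.sum _ fun x hx => ?_
      have hx' := Finset.HasAntidiagonal.mem_antidiagonal.1 hx
      split_ifs with h
      · exact IsNonnegPoly.const le_rfl
      · push Not at h
        exact (IsNonnegPoly.pow _).mul ((ih _ (by omega)).mul (hM _ (by omega)))
    refine key.congr fun q hq => ?_
    rw [Finset.prod_range_succ, PowerSeries.coeff_mul, Finset.mul_sum]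
    refine Finset.sum_congr rfl fun x hx => ?_
    have hx' := Finset.HasAntidiagonal.mem_antidiagonal.1 hx
    split_ifs with h
    · rcases h with h | h
      · rw [coeff_prod_rescale_eq_zero (hg0 q hq) _ h]; ring
      · rw [h, PowerSeries.coeff_rescale, PowerSeries.coeff_zero_eq_constantCoeff_apply, hg0 q hq]
        ring
    · push Not at h
      rw [PowerSeries.coeff_rescale, ← hx', choose_two_add]
      obtain ⟨d, hd⟩ := Nat.exists_eq_add_of_le h.1
      have hq0 : q ≠ 0 := hq.1.ne'
      have e1 : q ^ (x.1 * x.2) * ((1 / q) ^ n) ^ x.2 = q ^ ((x.1 - n) * x.2) := by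
        rw [hd, Nat.add_sub_cancel_left, add_mul, pow_add, ← pow_mul, one_div, inv_pow]
        field_simp
      rw [pow_add, pow_add, ← e1]
      ring

/-- Strong induction on g = z + ∑ φ_n g(z)⋯g(z/q^n): every product on the right has at least two
factors without constant term, so its coefficient of z^m involves only g_a with a < m. -/
theorem isNonnegPoly_coeff {φ : PowerSeries ℝ} (hφ0 : constantCoeff φ = 0)
    (hφ : ∀ n, 0 ≤ coeff n φ) {g : ℝ → PowerSeries ℝ}
    (hg : ∀ q ∈ Set.Ioo (0 : ℝ) 1, IsRightInverse q (PowerSeries.X * (1 - φ)) (g q)) (m : ℕ) :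
    IsNonnegPoly fun q => q ^ (m.choose 2) * coeff m (g q) := by
  induction m using Nat.strong_induction_on with
  | _ m ih =>
    rcases Nat.eq_zero_or_pos m with rfl | hm
    · refine (IsNonnegPoly.const le_rfl).congr fun q hq => ?_
      rw [PowerSeries.coeff_zero_eq_constantCoeff_apply, (hg q hq).1, mul_zero]
    obtain ⟨M, rfl⟩ : ∃ M, m = M + 1 := ⟨m - 1, by omega⟩
    have key : IsNonnegPoly fun q => q ^ ((M + 1).choose 2) * (if M + 1 = 1 then 1 else 0) +
        ∑ n ∈ Finset.range M, coeff (n + 1) φ * (q ^ ((M + 1).choose 2) *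
          coeff (M + 1) (∏ k ∈ Finset.range (n + 2), rescale ((1 / q) ^ k) (g q))) := by
      refine ((IsNonnegPoly.pow _).mul (IsNonnegPoly.const ?_)).add (IsNonnegPoly.sum _ ?_)
      · split_ifs <;> simp
      · intro n _
        exact (IsNonnegPoly.const (hφ _)).mul
          (isNonnegPoly_coeff_prod (fun q hq => (hg q hq).1) ih (n + 2) (M + 1) (by omega))
    refine key.congr fun q hq => ?_
    have h := (hg q hq).2 (M + 1)
    rw [PowerSeries.coeff_X] at h
    have e (F : ℕ → ℝ) : ∑ n ∈ Finset.Icc 1 (M + 1), F n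
        = F 1 + ∑ n ∈ Finset.range M, F (n + 2) := by
      have : Finset.Icc 1 (M + 1) = Finset.Ico (0 + 1) (M + 1 + 1) := by ext; simp
      rw [this, ← Finset.sum_Ico_add' F 0 (M + 1) 1, ← Finset.range_eq_Ico,
        Finset.sum_range_succ', add_comm]
    rw [← h, e]
    have h1 : coeff 1 (PowerSeries.X * (1 - φ)) = 1 := by
      simp [hφ0, PowerSeries.coeff_succ_X_mul]
    have h2 (n : ℕ) : coeff (n + 2) (PowerSeries.X * (1 - φ)) = -coeff (n + 1) φ := by
      rw [show n + 2 = n + 1 + 1 from rfl, PowerSeries.coeff_succ_X_mul, map_sub,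
        PowerSeries.coeff_one, if_neg (by omega), zero_sub]
    simp only [h1, h2, Finset.range_one, Finset.prod_singleton, pow_zero, PowerSeries.rescale_one,
      RingHom.id_apply, mul_add, Finset.mul_sum, one_mul, neg_mul, Finset.sum_neg_distrib, mul_neg]
    rw [add_assoc, ← sub_eq_neg_add, sub_eq_zero.2, add_zero]
    exact Finset.sum_congr rfl fun n _ => by ring

/-! ### Linearization of the inverse equation -/

/-- The coefficients of the series `H` with `H(0) = 1` and `z H(r z) = g(z) H(z)`. -/
noncomputable def ratioCoeff (r : ℝ) (g : PowerSeries ℝ) : ℕ → ℝ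
  | 0 => 1
  -- The 1 subtracted is g_1: the term of g H containing the new coefficient has been moved to the
  -- left.
  | m + 1 => (r ^ (m + 1) - 1)⁻¹ * ∑ i : Fin (m + 1), coeff (m + 1 - i + 1) g * ratioCoeff r g i

theorem ratioCoeff_nonneg {r : ℝ} (hr : 1 < r) {g : PowerSeries ℝ} (hg : ∀ n, 0 ≤ coeff n g)
    (m : ℕ) : 0 ≤ ratioCoeff r g m := by
  induction m using Nat.strong_induction_on with
  | _ m ih =>
    cases m with
    | zero => simp [ratioCoeff]
    | succ m =>
      rw [ratioCoeff]
      refine mul_nonneg (inv_nonneg.2 (sub_nonneg.2 (one_le_pow₀ hr.le))) ?_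
      exact Finset.sum_nonneg fun i _ => mul_nonneg (hg _) (ih i i.2)

theorem pow_mul_ratioCoeff {r : ℝ} (hr : 1 < r) {g : PowerSeries ℝ} (h1 : coeff 1 g = 1)
    (m : ℕ) : r ^ m * ratioCoeff r g m =
      ∑ i ∈ Finset.range (m + 1), coeff (m - i + 1) g * ratioCoeff r g i := by
  cases m with
  | zero => simp [ratioCoeff, h1]
  | succ m =>
    have hne : r ^ (m + 1) - 1 ≠ 0 := (sub_pos.2 (one_lt_pow₀ hr (by omega))).ne'
    have : (r ^ (m + 1) - 1) * ratioCoeff r g (m + 1) =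
        ∑ i ∈ Finset.range (m + 1), coeff (m + 1 - i + 1) g * ratioCoeff r g i := by
      conv_lhs => rw [ratioCoeff]
      rw [mul_inv_cancel_left₀ hne,
        Finset.sum_range fun i => coeff (m + 1 - i + 1) g * ratioCoeff r g i]
    rw [Finset.sum_range_succ, ← this, Nat.sub_self, zero_add, h1]
    ring

theorem X_mul_rescale_mk_ratioCoeff {r : ℝ} (hr : 1 < r) {g : PowerSeries ℝ}
    (h0 : constantCoeff g = 0) (h1 : coeff 1 g = 1) :
    PowerSeries.X * rescale r (PowerSeries.mk (ratioCoeff r g)) =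
      g * PowerSeries.mk (ratioCoeff r g) := by
  obtain ⟨k, rfl⟩ := PowerSeries.X_dvd_iff.2 h0
  rw [mul_assoc]
  congr 1
  ext m
  rw [PowerSeries.coeff_rescale, PowerSeries.coeff_mk, pow_mul_ratioCoeff hr h1, mul_comm k,
    PowerSeries.coeff_mul, Finset.Nat.sum_antidiagonal_eq_sum_range_succ_mk]
  refine Finset.sum_congr rfl fun i _ => ?_
  rw [PowerSeries.coeff_succ_X_mul, PowerSeries.coeff_mk, mul_comm]

/-- Telescoping: g(r^k z) H(r^k z) = r^k z H(r^(k+1) z), so the factors of the product are absorbed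
one after the other. -/
theorem prod_rescale_mul {r : ℝ} {g H : PowerSeries ℝ}
    (hH : PowerSeries.X * rescale r H = g * H) (n : ℕ) :
    (∏ k ∈ Finset.range n, rescale (r ^ k) g) * H =
      PowerSeries.C (r ^ (n.choose 2)) * PowerSeries.X ^ n * rescale (r ^ n) H := by
  induction n with
  | zero => simp
  | succ n ih =>
    have h := congrArg (rescale (r ^ n)) hH
    rw [map_mul, map_mul, PowerSeries.rescale_rescale, PowerSeries.rescale_X, mul_comm r,
      ← pow_succ] at h
    rw [Finset.prod_range_succ, mul_right_comm, ih, mul_assoc _ _ (rescale (r ^ n) g),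
      mul_comm (rescale (r ^ n) H), ← h, choose_two_add n 1, pow_add, pow_add]
    simp only [map_mul]
    simp
    ring

theorem coeff_prod_rescale_mul {r : ℝ} {g H : PowerSeries ℝ}
    (hH : PowerSeries.X * rescale r H = g * H) {n m : ℕ} (hn : n ≤ m) :
    coeff m ((∏ k ∈ Finset.range n, rescale (r ^ k) g) * H) =
      r ^ (n.choose 2 + n * (m - n)) * coeff (m - n) H := by
  rw [prod_rescale_mul hH, mul_assoc, PowerSeries.coeff_C_mul, PowerSeries.coeff_X_pow_mul',
    if_pos hn, PowerSeries.coeff_rescale, pow_add, pow_mul, mul_assoc]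

/-- The linear equation satisfied by `H`. -/
theorem IsRightInverse.sum_eq {q : ℝ} {φ g H : PowerSeries ℝ}
    (h : IsRightInverse q (PowerSeries.X * (1 - φ)) g)
    (hH : PowerSeries.X * rescale (1 / q) H = g * H) (M : ℕ) :
    ∑ i ∈ Finset.range (M + 1), coeff i (1 - φ) *
      ((1 / q) ^ ((i + 1).choose 2 + (i + 1) * (M - i)) * coeff (M - i) H) = coeff M H := by
  set f := PowerSeries.X * (1 - φ) with hf
  set r := 1 / q
  -- This is the coefficient of z^(M+1) in the inverse equation multiplied by H. Letting n run up to
  -- M + 1 for every `x` adds only products of order above `x.1`, and it allows the sums to be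
  -- interchanged.
  have h1 : ∑ x ∈ Finset.HasAntidiagonal.antidiagonal (M + 1),
      (∑ n ∈ Finset.Icc 1 (M + 1),
        coeff n f * coeff x.1 (∏ k ∈ Finset.range n, rescale (r ^ k) g)) * coeff x.2 H
      = coeff (M + 1) (PowerSeries.X * H) := by
    rw [PowerSeries.coeff_mul]
    refine Finset.sum_congr rfl fun x hx => ?_
    have hx' := Finset.HasAntidiagonal.mem_antidiagonal.1 hx
    rw [← h.2 x.1]
    congr 1
    refine (Finset.sum_subset (Finset.Icc_subset_Icc_right (by omega)) fun n hn hn' => ?_).symm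
    rw [Finset.mem_Icc] at hn hn'
    rw [coeff_prod_rescale_eq_zero h.1 _ (by omega), mul_zero]
  rw [PowerSeries.coeff_succ_X_mul] at h1
  rw [← h1]
  simp only [Finset.sum_mul]
  rw [Finset.sum_comm]
  have e : Finset.Icc 1 (M + 1) = Finset.Ico (0 + 1) (M + 1 + 1) := by ext; simp
  rw [e, ← Finset.sum_Ico_add' _ 0 (M + 1) 1, ← Finset.range_eq_Ico]
  refine Finset.sum_congr rfl fun i hi => ?_
  have hi' := Finset.mem_range.1 hi
  simp only [mul_assoc]
  rw [← Finset.mul_sum, ← PowerSeries.coeff_mul, coeff_prod_rescale_mul hH (by omega), hf,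
    PowerSeries.coeff_succ_X_mul, show M + 1 - (i + 1) = M - i by omega]

/-- The series `∏_{j ≥ 1} 1 / (1 - φ(ζ q^j z))`, obtained from the right inverse `g`. -/
noncomputable def prodSeries (q ζ : ℝ) (g : PowerSeries ℝ) : PowerSeries ℝ :=
  PowerSeries.mk fun m => ζ ^ m * q ^ ((m + 1).choose 2) * ratioCoeff (1 / q) g m

section

variable {q ζ : ℝ} {φ g : PowerSeries ℝ}

theorem coeff_prodSeries_nonneg (hq : q ∈ Set.Ioo (0 : ℝ) 1) (hζ : 0 < ζ)
    (hg : ∀ n, 0 ≤ coeff n g) (m : ℕ) : 0 ≤ coeff m (prodSeries q ζ g) := by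
  rw [prodSeries, PowerSeries.coeff_mk]
  have := ratioCoeff_nonneg (one_lt_one_div hq.1 hq.2) hg m
  have := hq.1
  positivity

theorem coeff_zero_prodSeries : coeff 0 (prodSeries q ζ g) = 1 := by
  simp [prodSeries, ratioCoeff]

/-- This functional equation characterizes the product. It is the linear equation for H: in the term
with indices i and j, the weight q^((i+j+1) choose 2) cancels all powers of 1/q except the (1/q)^j
belonging to B(z/q). -/
theorem rescale_prodSeries_mul (hφ : constantCoeff φ = 0) (hq : q ∈ Set.Ioo (0 : ℝ) 1)
    (h : IsRightInverse q (PowerSeries.X * (1 - φ)) g) :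
    (1 - rescale ζ φ) * rescale (1 / q) (prodSeries q ζ g) = prodSeries q ζ g := by
  ext M
  have hH := X_mul_rescale_mk_ratioCoeff (one_lt_one_div hq.1 hq.2) h.1 (h.coeff_one hφ)
  have hs := h.sum_eq hH M
  have hq0 : q ≠ 0 := hq.1.ne'
  simp only [PowerSeries.coeff_mk] at hs
  rw [PowerSeries.coeff_mul, Finset.Nat.sum_antidiagonal_eq_sum_range_succ_mk, prodSeries,
    PowerSeries.coeff_mk, ← hs, Finset.mul_sum]
  refine Finset.sum_congr rfl fun i hi => ?_
  obtain ⟨j, rfl⟩ := Nat.exists_eq_add_of_le (Nat.lt_succ_iff.1 (Finset.mem_range.1 hi))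
  have e1 : (1 : PowerSeries ℝ) - rescale ζ φ = rescale ζ (1 - φ) := by simp
  rw [e1, PowerSeries.coeff_rescale, PowerSeries.coeff_rescale, PowerSeries.coeff_mk,
    Nat.add_sub_cancel_left, choose_two_succ_add]
  simp only [pow_add, one_div, inv_pow, add_mul, one_mul]
  field_simp

/-- The coefficients of `g` in terms of those of `prodSeries`. -/
theorem pow_mul_coeff_prodSeries (hφ : constantCoeff φ = 0) (hq : q ∈ Set.Ioo (0 : ℝ) 1)
    (h : IsRightInverse q (PowerSeries.X * (1 - φ)) g) (n : ℕ) :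
    coeff n (rescale (1 / q) (prodSeries q ζ g)) =
      ∑ i ∈ Finset.range (n + 1), coeff i (prodSeries q ζ g) * q ^ (i * (n - i)) *
        (ζ ^ (n - i) * q ^ ((n - i + 1).choose 2) * coeff (n - i + 1) g) := by
  have hs := pow_mul_ratioCoeff (one_lt_one_div hq.1 hq.2) (h.coeff_one hφ) n
  rw [PowerSeries.coeff_rescale, prodSeries, PowerSeries.coeff_mk, mul_left_comm, hs,
    Finset.mul_sum]
  refine Finset.sum_congr rfl fun i hi => ?_
  obtain ⟨j, rfl⟩ := Nat.exists_eq_add_of_le (Nat.lt_succ_iff.1 (Finset.mem_range.1 hi))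
  rw [PowerSeries.coeff_mk, Nat.add_sub_cancel_left, choose_two_succ_add]
  simp only [pow_add]
  ring

end

/-! ### Values of power series -/

theorem psEval_rescale (a : ℝ) (p : PowerSeries ℝ) (x : ℝ) :
    psEval (rescale a p) x = psEval p (a * x) := by
  simp only [psEval, PowerSeries.coeff_rescale, mul_pow]
  exact tsum_congr fun n => by ring

theorem coeff_mul_mul_pow (s t : PowerSeries ℝ) (x : ℝ) (n : ℕ) :
    coeff n (s * t) * x ^ n = ∑ k ∈ Finset.HasAntidiagonal.antidiagonal n,
      (coeff k.1 s * x ^ k.1) * (coeff k.2 t * x ^ k.2) := by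
  rw [PowerSeries.coeff_mul, Finset.sum_mul]
  refine Finset.sum_congr rfl fun k hk => ?_
  rw [← Finset.HasAntidiagonal.mem_antidiagonal.1 hk, pow_add]
  ring

theorem hasSum_mul {s t : PowerSeries ℝ} {x a b : ℝ}
    (hs : HasSum (fun n => coeff n s * x ^ n) a) (ht : HasSum (fun n => coeff n t * x ^ n) b) :
    HasSum (fun n => coeff n (s * t) * x ^ n) (a * b) := by
  have hs' := hs.summable.norm
  have ht' := ht.summable.norm
  simp only [coeff_mul_mul_pow]
  rw [← hs.tsum_eq, ← ht.tsum_eq, tsum_mul_tsum_eq_tsum_sum_antidiagonal_of_summable_norm hs' ht']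
  exact (summable_norm_sum_mul_antidiagonal_of_summable_norm hs' ht').of_norm.hasSum

theorem summable_coeff_mul_pow {p : PowerSeries ℝ} {K : ℝ} (h : ∀ n, |coeff n p| ≤ K) {x : ℝ}
    (hx : |x| < 1) : Summable fun n => coeff n p * x ^ n := by
  refine Summable.of_norm_bounded
    ((summable_geometric_of_lt_one (abs_nonneg x) hx).mul_left K) fun n => ?_
  rw [norm_mul, norm_pow, Real.norm_eq_abs, Real.norm_eq_abs]
  exact mul_le_mul_of_nonneg_right (h n) (by positivity)

/-! ### Renewal sequences -/

/-- The generating function of a probability distribution on the positive integers. -/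
structure IsProbSeries (p : PowerSeries ℝ) : Prop where
  constantCoeff_eq : constantCoeff p = 0
  nonneg : ∀ n, 0 ≤ coeff n p
  hasSum : HasSum (fun n => coeff n p) 1

namespace IsProbSeries

variable {p : PowerSeries ℝ} (hp : IsProbSeries p)
include hp

theorem coeff_le_one (n : ℕ) : coeff n p ≤ 1 :=
  le_hasSum hp.hasSum n fun m _ => hp.nonneg m

theorem abs_coeff_le_one (n : ℕ) : |coeff n p| ≤ 1 := by
  rw [abs_of_nonneg (hp.nonneg n)]; exact hp.coeff_le_one n

theorem one_sub_mul_inv : (1 - p) * (1 - p)⁻¹ = 1 :=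
  PowerSeries.mul_inv_cancel _ (by simp [hp.constantCoeff_eq])

theorem coeff_inv_zero : coeff 0 (1 - p)⁻¹ = 1 := by
  simp [hp.constantCoeff_eq]

theorem coeff_inv_succ (n : ℕ) : coeff (n + 1) (1 - p)⁻¹ =
    ∑ i ∈ Finset.range (n + 1), coeff (i + 1) p * coeff (n - i) (1 - p)⁻¹ := by
  have h := congrArg (coeff (n + 1)) hp.one_sub_mul_inv
  rw [sub_mul, one_mul, map_sub, PowerSeries.coeff_one, if_neg (by omega), sub_eq_zero] at h
  rw [h, PowerSeries.coeff_mul, Finset.Nat.sum_antidiagonal_eq_sum_range_succ_mk,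
    Finset.sum_range_succ', PowerSeries.coeff_zero_eq_constantCoeff_apply, hp.constantCoeff_eq,
    zero_mul, add_zero]
  exact Finset.sum_congr rfl fun i _ => by rw [Nat.add_sub_add_right]

/-- By the renewal equation, each term is a combination of earlier ones with nonnegative weights of
sum at most 1. -/
theorem coeff_inv_mem (n : ℕ) :
    0 ≤ coeff n (1 - p)⁻¹ ∧ coeff n (1 - p)⁻¹ ≤ 1 := by
  induction n using Nat.strong_induction_on with
  | _ n ih =>
    cases n with
    | zero => rw [hp.coeff_inv_zero]; norm_num
    | succ n =>
      rw [hp.coeff_inv_succ]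
      refine ⟨Finset.sum_nonneg fun i _ => mul_nonneg (hp.nonneg _) (ih _ (by omega)).1, ?_⟩
      calc _ ≤ ∑ i ∈ Finset.range (n + 1), coeff (i + 1) p := by
            refine Finset.sum_le_sum fun i _ => ?_
            exact mul_le_of_le_one_right (hp.nonneg _) (ih _ (by omega)).2
        _ ≤ ∑ i ∈ Finset.range (n + 2), coeff i p := by
            rw [Finset.sum_range_succ' _ (n + 1)]
            exact le_add_of_nonneg_right (hp.nonneg _)
        _ ≤ 1 := sum_le_hasSum _ (fun m _ => hp.nonneg m) hp.hasSum

theorem psEval_le {x : ℝ} (h0 : 0 ≤ x) (h1 : x < 1) : 0 ≤ psEval p x ∧ psEval p x ≤ x := by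
  have hs : Summable fun n => coeff n p * x ^ n :=
    summable_coeff_mul_pow hp.abs_coeff_le_one (by rwa [abs_of_nonneg h0])
  refine ⟨tsum_nonneg fun n => mul_nonneg (hp.nonneg n) (pow_nonneg h0 n), ?_⟩
  have h2 : HasSum (fun n => coeff n p * x) (1 * x) := hp.hasSum.mul_right x
  rw [one_mul] at h2
  refine hasSum_le (fun n => ?_) hs.hasSum h2
  cases n with
  | zero => simp [hp.constantCoeff_eq]
  | succ n =>
    exact mul_le_mul_of_nonneg_left (pow_le_of_le_one h0 h1.le (by omega)) (hp.nonneg _)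

theorem hasSum_one_sub {x : ℝ} (hx : |x| < 1) :
    HasSum (fun n => coeff n (1 - p) * x ^ n) (1 - psEval p x) := by
  have hs : Summable fun n => coeff n p * x ^ n := summable_coeff_mul_pow hp.abs_coeff_le_one hx
  have h1 : HasSum (fun n => coeff n (1 : PowerSeries ℝ) * x ^ n) 1 := by
    have := hasSum_ite_eq (α := ℝ) (0 : ℕ) 1
    refine this.congr_fun ?_
    intro n
    rw [PowerSeries.coeff_one]
    split_ifs with h <;> simp [h]
  simp only [map_sub, sub_mul]
  exact h1.sub hs.hasSum

theorem hasSum_inv {x : ℝ} (h0 : 0 ≤ x) (h1 : x < 1) :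
    HasSum (fun n => coeff n (1 - p)⁻¹ * x ^ n) (1 - psEval p x)⁻¹ := by
  have hx : |x| < 1 := by rwa [abs_of_nonneg h0]
  have hs : Summable fun n => coeff n (1 - p)⁻¹ * x ^ n :=
    summable_coeff_mul_pow (K := 1)
      (fun n => by rw [abs_of_nonneg (hp.coeff_inv_mem n).1]; exact (hp.coeff_inv_mem n).2) hx
  have h := hasSum_mul (hp.hasSum_one_sub hx) hs.hasSum
  rw [hp.one_sub_mul_inv] at h
  have h2 := h.tsum_eq
  rw [tsum_eq_single 0 (fun n hn => by rw [PowerSeries.coeff_one, if_neg hn, zero_mul])] at h2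
  simp only [PowerSeries.coeff_zero_one, pow_zero, mul_one] at h2
  rw [inv_eq_of_mul_eq_one_right h2.symm]
  exact hs.hasSum

end IsProbSeries

/-! ### The product -/

section Product

variable {p B : PowerSeries ℝ} {q : ℝ}

theorem rescale_eq_mul_inv (hp : IsProbSeries p) (hB : (1 - p) * rescale (1 / q) B = B) :
    rescale (1 / q) B = B * (1 - p)⁻¹ := by
  conv_rhs => rw [← hB]
  rw [mul_right_comm, hp.one_sub_mul_inv, one_mul]

/-- Since the renewal sequence is at most 1, q^(-m) B_m is at most the partial sum S_{m+1} = S_m +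
B_m. Solving for B_m gives S_{m+1} ≤ S_m (1 + q^m/(1 - q)), and the product of these factors
converges. -/
theorem exists_coeff_le (hp : IsProbSeries p) (hq : q ∈ Set.Ioo (0 : ℝ) 1)
    (hB : (1 - p) * rescale (1 / q) B = B) (hB0 : coeff 0 B = 1) (hBn : ∀ n, 0 ≤ coeff n B) :
    ∃ K, ∀ n, coeff n (rescale (1 / q) B) ≤ K := by
  have hq1 : 0 < 1 - q := sub_pos.2 hq.2
  set S : ℕ → ℝ := fun m => ∑ i ∈ Finset.range m, coeff i B with hS
  have hS0 (m : ℕ) : 0 ≤ S m := Finset.sum_nonneg fun i _ => hBn i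
  have hW (m : ℕ) : coeff m (rescale (1 / q) B) ≤ S (m + 1) := by
    rw [rescale_eq_mul_inv hp hB, PowerSeries.coeff_mul,
      Finset.Nat.sum_antidiagonal_eq_sum_range_succ_mk]
    exact Finset.sum_le_sum fun i _ => mul_le_of_le_one_right (hBn i) (hp.coeff_inv_mem _).2
  have hstep (m : ℕ) (hm : 1 ≤ m) : S (m + 1) ≤ S m * (1 + q ^ m / (1 - q)) := by
    have h1 := hW m
    have h2 : S (m + 1) = S m + coeff m B := Finset.sum_range_succ _ _
    rw [h2, PowerSeries.coeff_rescale, one_div, inv_pow, inv_mul_le_iff₀ (pow_pos hq.1 m)] at h1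
    have h3 : q ^ m ≤ q := pow_le_of_le_one hq.1.le hq.2.le (by omega)
    have h4 : coeff m B * (1 - q) ≤ q ^ m * S m := by
      nlinarith [mul_nonneg (hBn m) (sub_nonneg.2 h3)]
    rw [h2, mul_add, mul_one, add_le_add_iff_left, ← mul_div_assoc, le_div_iff₀ hq1,
      mul_comm (S m)]
    exact h4
  have hexp (m : ℕ) : S (m + 1) ≤ Real.exp (∑ i ∈ Finset.range (m + 1), q ^ i / (1 - q)) := by
    induction m with
    | zero =>
      have : S (0 + 1) = 1 := by simp only [hS]; simp [hB0]
      rw [this]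
      refine Real.one_le_exp (Finset.sum_nonneg fun i _ => ?_)
      exact div_nonneg (pow_nonneg hq.1.le i) hq1.le
    | succ m ih =>
      rw [Finset.sum_range_succ, Real.exp_add]
      refine (hstep (m + 1) (by omega)).trans (mul_le_mul ih ?_ ?_ (Real.exp_pos _).le)
      · rw [add_comm]; exact Real.add_one_le_exp _
      · exact add_nonneg zero_le_one (div_nonneg (pow_nonneg hq.1.le _) hq1.le)
  refine ⟨Real.exp ((1 - q)⁻¹ / (1 - q)), fun n => (hW n).trans ((hexp n).trans ?_)⟩
  rw [Real.exp_le_exp, ← Finset.sum_div]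
  refine div_le_div_of_nonneg_right ?_ hq1.le
  exact sum_le_hasSum _ (fun i _ => pow_nonneg hq.1.le i)
    (hasSum_geometric_of_lt_one hq.1.le hq.2)

theorem coeff_le_of_rescale_le {K : ℝ} (hq : q ∈ Set.Ioo (0 : ℝ) 1)
    (hK : ∀ n, coeff n (rescale (1 / q) B) ≤ K) (n : ℕ) : coeff n B ≤ K * q ^ n := by
  have := hK n
  rwa [PowerSeries.coeff_rescale, one_div, inv_pow, inv_mul_le_iff₀ (pow_pos hq.1 n),
    mul_comm] at this

theorem summable_coeff (hp : IsProbSeries p) (hq : q ∈ Set.Ioo (0 : ℝ) 1)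
    (hB : (1 - p) * rescale (1 / q) B = B) (hB0 : coeff 0 B = 1) (hBn : ∀ n, 0 ≤ coeff n B) :
    Summable fun n => coeff n B := by
  obtain ⟨K, hK⟩ := exists_coeff_le hp hq hB hB0 hBn
  exact Summable.of_nonneg_of_le hBn (coeff_le_of_rescale_le hq hK)
    ((summable_geometric_of_lt_one hq.1.le hq.2).mul_left K)

/-- The functional equation at q^(j+1) gives (1 - p(q^(j+1))) B(q^j) = B(q^(j+1)), so the partial
products times B(1) are B(q^n), which tends to B(0) = 1. Convergence of the product comes from 0 ≤
p(x) ≤ x. -/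
theorem multipliable_and_tprod_mul (hp : IsProbSeries p) (hq : q ∈ Set.Ioo (0 : ℝ) 1)
    (hB : (1 - p) * rescale (1 / q) B = B) (hB0 : coeff 0 B = 1) (hBn : ∀ n, 0 ≤ coeff n B) :
    Multipliable (fun j : ℕ => 1 - psEval p (q ^ (j + 1))) ∧
      (∏' j : ℕ, (1 - psEval p (q ^ (j + 1)))) * ∑' n, coeff n B = 1 := by
  have hs := summable_coeff hp hq hB hB0 hBn
  have hqj (j : ℕ) : 0 ≤ q ^ (j + 1) ∧ q ^ (j + 1) < 1 :=
    ⟨pow_nonneg hq.1.le _, pow_lt_one₀ hq.1.le hq.2 (by omega)⟩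
  have hsj (j : ℕ) : Summable fun n => coeff n B * (q ^ j) ^ n :=
    Summable.of_nonneg_of_le (fun n => mul_nonneg (hBn n) (pow_nonneg (pow_nonneg hq.1.le _) _))
      (fun n => mul_le_of_le_one_right (hBn n)
        (pow_le_one₀ (pow_nonneg hq.1.le _) (pow_le_one₀ hq.1.le hq.2.le))) hs
  have hfun (j : ℕ) : (1 - psEval p (q ^ (j + 1))) * psEval B (q ^ j)
      = psEval B (q ^ (j + 1)) := by
    have h1 : HasSum (fun n => coeff n (rescale (1 / q) B) * (q ^ (j + 1)) ^ n)
        (psEval B (q ^ j)) := by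
      refine (hsj j).hasSum.congr_fun fun n => ?_
      have := hq.1.ne'
      rw [PowerSeries.coeff_rescale, pow_succ q j, mul_pow, one_div, inv_pow]
      field_simp
    have h2 := hasSum_mul
      (hp.hasSum_one_sub (by rw [abs_of_nonneg (hqj j).1]; exact (hqj j).2)) h1
    rw [hB] at h2
    exact h2.tsum_eq.symm
  have hprod (n : ℕ) : (∏ j ∈ Finset.range n, (1 - psEval p (q ^ (j + 1)))) * ∑' n, coeff n B
      = psEval B (q ^ n) := by
    induction n with
    | zero => simp [psEval]
    | succ n ih => rw [Finset.prod_range_succ, mul_right_comm, ih, mul_comm, hfun]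
  have hlim : Tendsto (fun n : ℕ => psEval B (q ^ n)) atTop (𝓝 1) := by
    have h : Tendsto (fun n : ℕ => ∑' m, coeff m B * (q ^ n) ^ m) atTop
        (𝓝 (∑' m, if m = 0 then (1 : ℝ) else 0)) := by
      refine tendsto_tsum_of_dominated_convergence hs (fun m => ?_) (Eventually.of_forall ?_)
      · split_ifs with hm
        · simp [hm, hB0]
        · have h0 : Tendsto (fun n : ℕ => (q ^ n) ^ m) atTop (𝓝 (0 ^ m)) :=
            (tendsto_pow_atTop_nhds_zero_of_lt_one hq.1.le hq.2).pow m
          rw [zero_pow hm] at h0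
          simpa using h0.const_mul (coeff m B)
      · intro n m
        rw [Real.norm_of_nonneg (mul_nonneg (hBn m) (pow_nonneg (pow_nonneg hq.1.le _) _))]
        exact mul_le_of_le_one_right (hBn m)
          (pow_le_one₀ (pow_nonneg hq.1.le _) (pow_le_one₀ hq.1.le hq.2.le))
    rwa [tsum_ite_eq] at h
  have hm : Multipliable (fun j : ℕ => 1 - psEval p (q ^ (j + 1))) := by
    have hsum : Summable fun j : ℕ => ‖-psEval p (q ^ (j + 1))‖ := by
      refine Summable.of_nonneg_of_le (fun _ => norm_nonneg _) (fun j => ?_)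
        ((summable_nat_add_iff 1).2 (summable_geometric_of_lt_one hq.1.le hq.2))
      have := hp.psEval_le (hqj j).1 (hqj j).2
      rw [norm_neg, Real.norm_of_nonneg this.1]
      exact this.2
    simpa only [sub_eq_add_neg] using multipliable_one_add_of_summable hsum
  refine ⟨hm, tendsto_nhds_unique (hm.hasProd.tendsto_prod_nat.mul_const _) ?_⟩
  simpa only [hprod] using hlim

end Product

/-! ### Transfer from the renewal sequence -/

section Transfer

variable {c : ℕ → ℝ}

/-- Subexponential decay, the source of the dominating bounds below. Beyond some N each step loses
at most a factor a; for smaller indices c ≤ 1 is used, at the price of the constant 1/c_N. -/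
theorem exists_le_mul_pow_mul (hc1 : ∀ n, c n ≤ 1) (hpos : ∀ᶠ n in atTop, 0 < c n)
    (hratio : Tendsto (fun n => c n / c (n + 1)) atTop (𝓝 1)) {a : ℝ} (ha : 1 < a) :
    ∃ C, 0 ≤ C ∧ ∀ᶠ n in atTop, 0 < c n ∧ ∀ m ≤ n, c m ≤ C * a ^ (n - m) * c n := by
  obtain ⟨N, hN⟩ := eventually_atTop.1 (hpos.and (hratio.eventually (gt_mem_nhds ha)))
  have hstep (m n : ℕ) (hm : N ≤ m) (hmn : m ≤ n) : c m ≤ a ^ (n - m) * c n := by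
    induction n, hmn using Nat.le_induction with
    | base => simp
    | succ n hmn ih =>
      have h := (hN n (by omega)).2
      rw [div_lt_iff₀ (hN (n + 1) (by omega)).1] at h
      rw [Nat.sub_add_comm hmn, pow_succ, mul_assoc]
      exact ih.trans (mul_le_mul_of_nonneg_left h.le (by positivity))
  have hcN := (hN N le_rfl).1
  have h1 : 1 ≤ (c N)⁻¹ := (one_le_inv₀ hcN).2 (hc1 N)
  refine ⟨(c N)⁻¹, by positivity, eventually_atTop.2 ⟨N, fun n hn => ⟨(hN n hn).1, fun m hm => ?_⟩⟩⟩
  have hcn := (hN n hn).1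
  rcases le_total N m with h | h
  · rw [mul_assoc]
    exact (hstep m n h hm).trans (le_mul_of_one_le_left (by positivity) h1)
  · refine (hc1 m).trans ?_
    rw [mul_assoc, ← div_eq_inv_mul, one_le_div hcN]
    refine (hstep N n le_rfl hn).trans ?_
    gcongr
    exact ha.le

theorem tendsto_div_add (hpos : ∀ᶠ n in atTop, 0 < c n)
    (hratio : Tendsto (fun n => c n / c (n + 1)) atTop (𝓝 1)) (i : ℕ) :
    Tendsto (fun n => c n / c (n + i)) atTop (𝓝 1) := by
  induction i with
  | zero =>
    refine tendsto_const_nhds.congr' ?_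
    filter_upwards [hpos] with n hn
    rw [add_zero, div_self hn.ne']
  | succ i ih =>
    have h := ih.mul (hratio.comp (tendsto_add_atTop_nat i))
    rw [mul_one] at h
    refine h.congr' ?_
    filter_upwards [(tendsto_add_atTop_nat i).eventually hpos] with n hn
    simp only [Function.comp]
    rw [add_assoc, div_mul_div_cancel₀ hn.ne']

/-- Dominated convergence: c_{n-i}/c_n tends to 1 for each i and is at most C a^i, where a < 1/q
makes ∑ q^i a^i finite. -/
theorem tendsto_convolution_div (hc0 : ∀ n, 0 ≤ c n) (hc1 : ∀ n, c n ≤ 1)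
    (hpos : ∀ᶠ n in atTop, 0 < c n)
    (hratio : Tendsto (fun n => c n / c (n + 1)) atTop (𝓝 1)) {b : ℕ → ℝ} {K q : ℝ}
    (hq : q ∈ Set.Ioo (0 : ℝ) 1) (hb0 : ∀ n, 0 ≤ b n) (hb : ∀ n, b n ≤ K * q ^ n) :
    Tendsto (fun n => (∑ i ∈ Finset.range (n + 1), b i * c (n - i)) / c n) atTop
      (𝓝 (∑' i, b i)) := by
  have hqi : 1 < 1 / q := one_lt_one_div hq.1 hq.2
  obtain ⟨a, ha1, ha2⟩ := exists_between hqi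
  have haq : q * a < 1 := by rw [lt_div_iff₀ hq.1] at ha2; linarith
  have hq0 := hq.1
  obtain ⟨C, hC, hev⟩ := exists_le_mul_pow_mul hc1 hpos hratio ha1
  have hlim : Tendsto (fun n => ∑' i, if i ≤ n then b i * (c (n - i) / c n) else 0) atTop
      (𝓝 (∑' i, b i)) := by
    refine tendsto_tsum_of_dominated_convergence (bound := fun i => K * C * (q * a) ^ i)
      ((summable_geometric_of_lt_one (by positivity) haq).mul_left _) (fun i => ?_) ?_
    · have h1 : Tendsto (fun n => c (n - i) / c n) atTop (𝓝 1) := by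
        rw [← tendsto_add_atTop_iff_nat i]
        simpa using tendsto_div_add hpos hratio i
      have h2 := h1.const_mul (b i)
      rw [mul_one] at h2
      refine h2.congr' ?_
      filter_upwards [eventually_ge_atTop i] with n hn
      rw [if_pos hn]
    · filter_upwards [hev] with n hn i
      have hK : 0 ≤ K * q ^ i := (hb0 i).trans (hb i)
      split_ifs with hi
      · rw [Real.norm_of_nonneg (mul_nonneg (hb0 i) (div_nonneg (hc0 _) hn.1.le)), mul_pow,
          show K * C * (q ^ i * a ^ i) = (K * q ^ i) * (C * a ^ i) by ring]
        refine mul_le_mul (hb i) ?_ (div_nonneg (hc0 _) hn.1.le) hK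
        rw [div_le_iff₀ hn.1]
        have := hn.2 (n - i) (Nat.sub_le _ _)
        rwa [Nat.sub_sub_self hi] at this
      · rw [norm_zero, mul_pow, show K * C * (q ^ i * a ^ i) = (K * q ^ i) * (C * a ^ i) by ring]
        positivity
  refine hlim.congr fun n => ?_
  rw [tsum_eq_sum (s := Finset.range (n + 1)) (fun i hi => if_neg (by simpa using hi)),
    Finset.sum_div]
  refine Finset.sum_congr rfl fun i hi => ?_
  rw [if_pos (by simpa [Nat.lt_succ_iff] using hi), mul_div_assoc]

/-- The term i = 0 is u_n. For 1 ≤ i ≤ n the decay of b_i supplies q^i, and i + i(n - i) ≥ n, so the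
rest is at most n K² q^n. This is o(c_n), because 1 = c_0 ≤ C a^n c_n with qa < 1. -/
theorem tendsto_perturbed_div (hc0 : c 0 = 1) (hc1 : ∀ n, c n ≤ 1)
    (hpos : ∀ᶠ n in atTop, 0 < c n)
    (hratio : Tendsto (fun n => c n / c (n + 1)) atTop (𝓝 1)) {b u w : ℕ → ℝ} {K q l : ℝ}
    (hq : q ∈ Set.Ioo (0 : ℝ) 1) (hb0 : ∀ n, 0 ≤ b n) (hb1 : b 0 = 1)
    (hb : ∀ n, b n ≤ K * q ^ n) (hu : ∀ n, 0 ≤ u n) (hw : ∀ n, w n ≤ K)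
    (huw : ∀ n, w n = ∑ i ∈ Finset.range (n + 1), b i * q ^ (i * (n - i)) * u (n - i))
    (hlim : Tendsto (fun n => w n / c n) atTop (𝓝 l)) :
    Tendsto (fun n => u n / c n) atTop (𝓝 l) := by
  have hqi : 1 < 1 / q := one_lt_one_div hq.1 hq.2
  obtain ⟨a, ha1, ha2⟩ := exists_between hqi
  have haq : q * a < 1 := by rw [lt_div_iff₀ hq.1] at ha2; linarith
  have hq0 := hq.1
  obtain ⟨C, hC, hev⟩ := exists_le_mul_pow_mul hc1 hpos hratio ha1
  have hsplit (n : ℕ) : w n = u n + ∑ i ∈ Finset.range n,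
      b (i + 1) * q ^ ((i + 1) * (n - (i + 1))) * u (n - (i + 1)) := by
    rw [huw, Finset.sum_range_succ', hb1, zero_mul, pow_zero, Nat.sub_zero, add_comm]
    ring
  have hterm (n i : ℕ) : 0 ≤ b (i + 1) * q ^ ((i + 1) * (n - (i + 1))) * u (n - (i + 1)) :=
    mul_nonneg (mul_nonneg (hb0 _) (by positivity)) (hu _)
  have huw' (n : ℕ) : u n ≤ w n := by
    rw [hsplit]
    exact le_add_of_nonneg_right (Finset.sum_nonneg fun i _ => hterm n i)
  have huK (n : ℕ) : u n ≤ K := (huw' n).trans (hw n)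
  have hK : 0 ≤ K := (hu 0).trans (huK 0)
  have herr (n : ℕ) : w n - u n ≤ n * (K * K * q ^ n) := by
    rw [hsplit, add_sub_cancel_left]
    calc _ ≤ ∑ i ∈ Finset.range n, K * K * q ^ n := by
          refine Finset.sum_le_sum fun i hi => ?_
          obtain ⟨j, rfl⟩ := Nat.exists_eq_add_of_lt (Finset.mem_range.1 hi)
          rw [show i + j + 1 - (i + 1) = j by omega]
          calc _ ≤ K * q ^ (i + 1) * q ^ ((i + 1) * j) * K :=
                mul_le_mul (mul_le_mul_of_nonneg_right (hb _) (by positivity)) (huK _) (hu _)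
                  (by positivity)
            _ = K * K * q ^ (i + 1 + (i + 1) * j) := by ring
            _ ≤ K * K * q ^ (i + j + 1) := by
                refine mul_le_mul_of_nonneg_left
                  (pow_le_pow_of_le_one hq0.le hq.2.le ?_) (by positivity)
                nlinarith [Nat.zero_le (i * j)]
      _ = _ := by rw [Finset.sum_const, Finset.card_range, nsmul_eq_mul]
  have hzero : Tendsto (fun n => (w n - u n) / c n) atTop (𝓝 0) := by
    have hg : Tendsto (fun n : ℕ => K * K * C * (n * (q * a) ^ n)) atTop (𝓝 0) := by
      simpa using (tendsto_self_mul_const_pow_of_lt_one (by positivity) haq).const_mul (K * K * C)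
    refine squeeze_zero' ?_ ?_ hg
    · filter_upwards [hev] with n hn
      exact div_nonneg (sub_nonneg.2 (huw' n)) hn.1.le
    · filter_upwards [hev] with n hn
      rw [div_le_iff₀ hn.1]
      have h1 := hn.2 0 (Nat.zero_le _)
      rw [hc0, Nat.sub_zero] at h1
      calc _ ≤ n * (K * K * q ^ n) * 1 := by rw [mul_one]; exact herr n
        _ ≤ n * (K * K * q ^ n) * (C * a ^ n * c n) :=
            mul_le_mul_of_nonneg_left h1 (by positivity)
        _ = _ := by rw [mul_pow]; ring
  have := hlim.sub hzero
  rw [sub_zero] at this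
  exact this.congr fun n => by rw [← sub_div, sub_sub_cancel]

end Transfer

/-- If the renewal sequence `c` with generating function `1 / (1 - φ(ζ z))` satisfies
`c_n ∼ c_{n+1}`, then `ζ^n q^((n+1) choose 2) g_{n+1} ∼ c_n / ∏_{j ≥ 1} (1 - φ(ζ q^j))`. -/
theorem IsRightInverse.tendsto_div {q ζ : ℝ} {φ g : PowerSeries ℝ} (hq : q ∈ Set.Ioo (0 : ℝ) 1)
    (hζ : 0 < ζ) (hφ : constantCoeff φ = 0) (hp : IsProbSeries (rescale ζ φ))
    (h : IsRightInverse q (PowerSeries.X * (1 - φ)) g) (hg : ∀ n, 0 ≤ coeff n g)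
    (hpos : ∀ᶠ n in atTop, 0 < coeff n (1 - rescale ζ φ)⁻¹)
    (hratio : Tendsto (fun n => coeff n (1 - rescale ζ φ)⁻¹ / coeff (n + 1) (1 - rescale ζ φ)⁻¹)
      atTop (𝓝 1)) :
    Multipliable (fun j : ℕ => 1 - psEval φ (ζ * q ^ (j + 1))) ∧
    0 < ∏' j : ℕ, (1 - psEval φ (ζ * q ^ (j + 1))) ∧
    Tendsto (fun n => ζ ^ n * q ^ ((n + 1).choose 2) * coeff (n + 1) g /
      coeff n (1 - rescale ζ φ)⁻¹) atTop (𝓝 (∏' j : ℕ, (1 - psEval φ (ζ * q ^ (j + 1))))⁻¹) := by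
  set B := prodSeries q ζ g with hBdef
  have hB : (1 - rescale ζ φ) * rescale (1 / q) B = B := rescale_prodSeries_mul hφ hq h
  have hB0 : coeff 0 B = 1 := coeff_zero_prodSeries
  have hBn : ∀ n, 0 ≤ coeff n B := coeff_prodSeries_nonneg hq hζ hg
  obtain ⟨K, hK⟩ := exists_coeff_le hp hq hB hB0 hBn
  have hbK := coeff_le_of_rescale_le hq hK
  obtain ⟨hm, hprod⟩ := multipliable_and_tprod_mul hp hq hB hB0 hBn
  simp only [psEval_rescale] at hm hprod
  have hsum : 0 < ∑' n, coeff n B :=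
    (summable_coeff hp hq hB hB0 hBn).tsum_pos hBn 0 (by rw [hB0]; exact one_pos)
  refine ⟨hm, pos_of_mul_pos_left (by rw [hprod]; exact one_pos) hsum.le, ?_⟩
  rw [inv_eq_of_mul_eq_one_right hprod]
  have hq0 := hq.1
  refine tendsto_perturbed_div (w := fun n => coeff n (rescale (1 / q) B)) hp.coeff_inv_zero
    (fun n => (hp.coeff_inv_mem n).2) hpos hratio hq hBn hB0 hbK
    (fun n => mul_nonneg (by positivity) (hg _)) hK
    (fun n => pow_mul_coeff_prodSeries hφ hq h n) ?_
  refine (tendsto_convolution_div (fun n => (hp.coeff_inv_mem n).1)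
    (fun n => (hp.coeff_inv_mem n).2) hpos hratio hq hBn hbK).congr fun n => ?_
  rw [rescale_eq_mul_inv hp hB, PowerSeries.coeff_mul,
    Finset.Nat.sum_antidiagonal_eq_sum_range_succ_mk]

/-! ### Regular variation: uniform convergence and Potter's bounds -/

open MeasureTheory in
/-- The uniform convergence theorem for slowly varying functions, in additive form. -/
theorem eventually_abs_sub_le_of_tendsto {k : ℝ → ℝ} (hk : Measurable k)
    (h : ∀ s : ℝ, Tendsto (fun x => k (x + s) - k x) atTop (𝓝 0)) {ε : ℝ} (hε : 0 < ε) :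
    ∃ X, ∀ x, X ≤ x → ∀ u ∈ Set.Icc (0 : ℝ) 1, |k (x + u) - k x| ≤ ε := by
  -- Truncation at 1 provides a dominating function, so pointwise convergence in s passes to
  -- integrals over s.
  set d : ℝ → ℝ → ℝ := fun x s => min 1 |k (x + s) - k x| with hd
  have hd0 (x s : ℝ) : 0 ≤ d x s := le_min zero_le_one (abs_nonneg _)
  have hdm (x : ℝ) : Measurable (d x) := by
    have : Measurable fun s => k (x + s) := hk.comp (measurable_const_add x)
    have h2 : Measurable fun s => |k (x + s) - k x| := measurable_abs.comp (this.sub_const (k x))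
    exact measurable_const.min h2
  have hint (x a b : ℝ) : IntervalIntegrable (d x) volume a b := by
    refine (intervalIntegrable_const (c := (1 : ℝ))).mono_fun (hdm x).aestronglyMeasurable ?_
    refine Eventually.of_forall fun s => ?_
    simp only [Real.norm_of_nonneg (hd0 x s), norm_one]
    exact min_le_left _ _
  have hD : Tendsto (fun x => ∫ s in (0 : ℝ)..2, d x s) atTop (𝓝 0) := by
    have := intervalIntegral.tendsto_integral_filter_of_dominated_convergence
      (μ := volume) (a := (0 : ℝ)) (b := 2) (F := d) (f := fun _ => (0 : ℝ)) (l := atTop)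
      (fun _ => (1 : ℝ)) (Eventually.of_forall fun x => (hdm x).aestronglyMeasurable)
      (Eventually.of_forall fun x => Eventually.of_forall fun s _ => by
        rw [Real.norm_of_nonneg (hd0 x s)]; exact min_le_left _ _)
      intervalIntegrable_const
      (Eventually.of_forall fun s _ => by
        have h1 := ((h s).abs)
        rw [abs_zero] at h1
        simpa using (tendsto_const_nhds (x := (1 : ℝ))).min h1)
    simpa using this
  -- Average over l in [1, 2] the triangle inequality through the point x + l. Since [1 - u, 2 - u]
  -- lies in [0, 2], both integrals are over a range independent of u, which gives uniformity.
  have hkey (x u : ℝ) (hu : u ∈ Set.Icc (0 : ℝ) 1) : min 1 |k (x + u) - k x| ≤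
      (∫ s in (0 : ℝ)..2, d x s) + ∫ s in (0 : ℝ)..2, d (x + u) s := by
    have hpt (l : ℝ) : min 1 |k (x + u) - k x| ≤ d x l + d (x + u) (l - u) := by
      have e : x + u + (l - u) = x + l := by ring
      simp only [hd, e]
      have tri : |k (x + u) - k x| ≤ |k (x + l) - k x| + |k (x + l) - k (x + u)| := by
        rw [abs_sub_comm (k (x + l)) (k (x + u)), add_comm |k (x + l) - k x|]
        exact abs_sub_le _ _ _
      rcases le_total 1 |k (x + l) - k x| with h1 | h1
      · rw [min_eq_left h1]
        exact (min_le_left _ _).trans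
          (le_add_of_nonneg_right (le_min zero_le_one (abs_nonneg _)))
      · rcases le_total 1 |k (x + l) - k (x + u)| with h2 | h2
        · rw [min_eq_left h2]
          exact (min_le_left _ _).trans
            (le_add_of_nonneg_left (le_min zero_le_one (abs_nonneg _)))
        · rw [min_eq_right h1, min_eq_right h2]
          exact (min_le_right _ _).trans tri
    have hi2 : IntervalIntegrable (fun l => d (x + u) (l - u)) volume 1 2 := by
      have := (hint (x + u) (1 - u) (2 - u)).comp_sub_right u
      simpa using this
    have h1 : ∫ _ in (1 : ℝ)..2, min 1 |k (x + u) - k x| ≤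
        ∫ l in (1 : ℝ)..2, (d x l + d (x + u) (l - u)) :=
      intervalIntegral.integral_mono_on (by norm_num) intervalIntegrable_const
        ((hint x 1 2).add hi2) fun l _ => hpt l
    rw [intervalIntegral.integral_add (hint x 1 2) hi2,
      intervalIntegral.integral_comp_sub_right (d (x + u)) u] at h1
    have h2 : ∫ s in (1 : ℝ)..2, d x s ≤ ∫ s in (0 : ℝ)..2, d x s :=
      intervalIntegral.integral_mono_interval (by norm_num) (by norm_num) le_rfl
        (Eventually.of_forall fun s => hd0 x s) (hint x 0 2)
    have h3 : ∫ s in (1 - u)..(2 - u), d (x + u) s ≤ ∫ s in (0 : ℝ)..2, d (x + u) s :=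
      intervalIntegral.integral_mono_interval (by linarith [hu.2]) (by linarith)
        (by linarith [hu.1]) (Eventually.of_forall fun s => hd0 _ s) (hint _ 0 2)
    have h4 : ∫ _ in (1 : ℝ)..2, min 1 |k (x + u) - k x| = min 1 |k (x + u) - k x| := by
      rw [intervalIntegral.integral_const, smul_eq_mul]
      norm_num
    linarith
  -- Below 1/2 the truncation at 1 cannot be active.
  set η := min ε (1 / 2) with hη
  have hη0 : 0 < η := lt_min hε (by norm_num)
  obtain ⟨X, hX⟩ := eventually_atTop.1 (hD.eventually (gt_mem_nhds (half_pos hη0)))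
  refine ⟨X, fun x hx u hu => ?_⟩
  have h1 := hkey x u hu
  have h2 := hX x hx
  have h3 := hX (x + u) (by linarith [hu.1])
  have h4 : min 1 |k (x + u) - k x| < η := by linarith
  rcases min_lt_iff.1 h4 with h5 | h5
  · linarith [min_le_right ε (1 / 2)]
  · exact h5.le.trans (min_le_left _ _)

/-- Chain ⌊u⌋ unit steps and one fractional step. -/
theorem abs_sub_le_mul_of_forall {k : ℝ → ℝ} {ε X : ℝ}
    (h : ∀ x, X ≤ x → ∀ u ∈ Set.Icc (0 : ℝ) 1, |k (x + u) - k x| ≤ ε)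
    {x : ℝ} (hx : X ≤ x) {u : ℝ} (hu : 0 ≤ u) : |k (x + u) - k x| ≤ ε * (1 + u) := by
  have hε : 0 ≤ ε := (abs_nonneg _).trans (h x hx 0 (by simp))
  have key (n : ℕ) : ∀ v ∈ Set.Icc (0 : ℝ) 1, |k (x + (n + v)) - k x| ≤ ε * (1 + n) := by
    induction n with
    | zero => intro v hv; simpa using h x hx v hv
    | succ n ih =>
      intro v hv
      have h1 := ih 1 (by simp)
      have h2 := h (x + (n + 1)) (by linarith [Nat.cast_nonneg (α := ℝ) n]) v hv
      have e : x + (n + 1) + v = x + ((n + 1 : ℕ) + v) := by push_cast; ring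
      rw [e] at h2
      have h3 := abs_sub_le (k (x + ((n + 1 : ℕ) + v))) (k (x + (n + 1))) (k x)
      push_cast at *
      linarith
  have h1 := key ⌊u⌋₊ (u - ⌊u⌋₊)
    ⟨by linarith [Nat.floor_le hu], by linarith [Nat.lt_floor_add_one u]⟩
  rw [add_sub_cancel] at h1
  exact h1.trans (by gcongr; exact Nat.floor_le hu)

section RegVar

variable {c : ℕ → ℝ} {σ : ℝ}

theorem RegularlyVaryingSeq.eventually_pos (h : RegularlyVaryingSeq c σ) (hc : ∀ n, 0 ≤ c n) :
    ∀ᶠ n in atTop, 0 < c n := by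
  -- The ratio c_n/c_n tends to 1, whereas it would be 0 at any n with c_n = 0.
  have h1 := (h 1 one_pos).comp (tendsto_natCast_atTop_atTop (R := ℝ))
  rw [Real.one_rpow] at h1
  filter_upwards [h1.eventually (lt_mem_nhds one_half_lt_one)] with n hn
  simp only [Function.comp, Nat.floor_natCast, one_mul] at hn
  refine (hc n).lt_of_ne fun h0 => ?_
  rw [← h0] at hn
  norm_num at hn

/-- In the variable x = log t, regular variation is an additive condition, and subtracting σx
reduces it to index 0, the hypothesis of the uniform convergence theorem. -/
theorem RegularlyVaryingSeq.tendsto_log (h : RegularlyVaryingSeq c σ) (hc : ∀ n, 0 ≤ c n)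
    (s : ℝ) : Tendsto (fun x => (Real.log (c ⌊Real.exp (x + s)⌋₊) - σ * (x + s)) -
      (Real.log (c ⌊Real.exp x⌋₊) - σ * x)) atTop (𝓝 0) := by
  have h1 := (h (Real.exp s) (Real.exp_pos s)).comp Real.tendsto_exp_atTop
  have h2 := h1.log (Real.rpow_pos_of_pos (Real.exp_pos s) σ).ne'
  rw [← Real.exp_mul, Real.log_exp] at h2
  have h3 := h2.sub_const (s * σ)
  rw [sub_self] at h3
  refine h3.congr' ?_
  have hfl : Tendsto (fun x : ℝ => ⌊Real.exp x⌋₊) atTop atTop :=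
    tendsto_nat_floor_atTop.comp Real.tendsto_exp_atTop
  have hp := hfl.eventually (h.eventually_pos hc)
  filter_upwards [hp, (tendsto_atTop_add_const_right _ s tendsto_id).eventually hp] with x hx hx'
  simp only [Function.comp, id] at hx' ⊢
  rw [← Real.exp_add, add_comm s x, Real.log_div hx'.ne' hx.ne']
  ring

/-- Potter's bounds, in logarithmic form. -/
theorem RegularlyVaryingSeq.exists_abs_log_le (h : RegularlyVaryingSeq c σ)
    (hc : ∀ n, 0 ≤ c n) {ε : ℝ} (hε : 0 < ε) :
    ∃ N, 1 ≤ N ∧ ∀ m, N ≤ m → 0 < c m ∧ ∀ n, m ≤ n →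
      |(Real.log (c n) - σ * Real.log n) - (Real.log (c m) - σ * Real.log m)| ≤
        ε * (1 + (Real.log n - Real.log m)) := by
  have hmeas : Measurable fun x : ℝ => Real.log (c ⌊Real.exp x⌋₊) - σ * x := by
    refine Measurable.sub (Real.measurable_log.comp ?_) (measurable_id.const_mul σ)
    exact (measurable_from_top (f := c)).comp (Nat.measurable_floor.comp Real.measurable_exp)
  obtain ⟨X, hX⟩ := eventually_abs_sub_le_of_tendsto hmeas (h.tendsto_log hc) hε
  obtain ⟨N, hN⟩ := eventually_atTop.1 ((h.eventually_pos hc).and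
    ((eventually_ge_atTop 1).and ((Real.tendsto_log_atTop.comp
      (tendsto_natCast_atTop_atTop (R := ℝ))).eventually (eventually_ge_atTop X))))
  refine ⟨N, (hN N le_rfl).2.1, fun m hm => ⟨(hN m hm).1, fun n hn => ?_⟩⟩
  have hm0 : (0 : ℝ) < m := Nat.cast_pos.2 (hN m hm).2.1
  have hn0 : (0 : ℝ) < n := hm0.trans_le (Nat.cast_le.2 hn)
  have h1 := abs_sub_le_mul_of_forall
    (k := fun x => Real.log (c ⌊Real.exp x⌋₊) - σ * x) hX (hN m hm).2.2 (u := Real.log n - Real.log m)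
    (sub_nonneg.2 (Real.log_le_log hm0 (Nat.cast_le.2 hn)))
  simpa [Real.exp_log hm0, Real.exp_log hn0] using h1

/-- The ratio (n + 1)/n is not a fixed λ, so uniformity is needed: Potter's bound with arbitrary ε
is applied to n and n + 1, where log(n + 1) - log n tends to 0. -/
theorem RegularlyVaryingSeq.tendsto_div_succ (h : RegularlyVaryingSeq c σ) (hc : ∀ n, 0 ≤ c n) :
    Tendsto (fun n => c n / c (n + 1)) atTop (𝓝 1) := by
  have hlog : Tendsto (fun n : ℕ => Real.log (n + 1 : ℕ) - Real.log n) atTop (𝓝 0) := by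
    have h1 : Tendsto (fun n : ℕ => 1 + 1 / (n : ℝ)) atTop (𝓝 (1 + 0)) :=
      tendsto_const_nhds.add tendsto_one_div_atTop_nhds_zero_nat
    rw [add_zero] at h1
    have h2 := h1.log one_ne_zero
    rw [Real.log_one] at h2
    refine h2.congr' ?_
    filter_upwards [eventually_gt_atTop 0] with n hn
    have hn' : (0 : ℝ) < n := Nat.cast_pos.2 hn
    rw [← Real.log_div (by positivity) hn'.ne']
    congr 1
    push_cast
    field_simp
  have hdiff : Tendsto (fun n : ℕ => (Real.log (c (n + 1)) - σ * Real.log (n + 1 : ℕ)) -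
      (Real.log (c n) - σ * Real.log n)) atTop (𝓝 0) := by
    rw [Metric.tendsto_nhds]
    intro ε hε
    obtain ⟨N, -, hN⟩ := h.exists_abs_log_le hc (ε := ε / 4) (by positivity)
    filter_upwards [eventually_ge_atTop N, hlog.eventually (gt_mem_nhds one_pos)] with n hn hn1
    rw [Real.dist_eq, sub_zero]
    refine ((hN n hn).2 (n + 1) (by omega)).trans_lt ?_
    nlinarith
  have hl : Tendsto (fun n => Real.log (c n / c (n + 1))) atTop (𝓝 0) := by
    have := (hdiff.add (hlog.const_mul σ)).neg
    rw [mul_zero, add_zero, neg_zero] at this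
    refine this.congr' ?_
    have hp := h.eventually_pos hc
    filter_upwards [hp, (tendsto_add_atTop_nat 1).eventually hp] with n hn hn1
    rw [Real.log_div hn.ne' hn1.ne']
    ring
  have h2 := (Real.continuous_exp.tendsto 0).comp hl
  rw [Real.exp_zero] at h2
  refine h2.congr' ?_
  have hp := h.eventually_pos hc
  filter_upwards [hp, (tendsto_add_atTop_nat 1).eventually hp] with n hn hn1
  exact Real.exp_log (div_pos hn hn1)

/-- Potter's bounds. -/
theorem RegularlyVaryingSeq.exists_le_rpow (h : RegularlyVaryingSeq c σ)
    (hc : ∀ n, 0 ≤ c n) {ε : ℝ} (hε : 0 < ε) :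
    ∃ N : ℕ, 1 ≤ N ∧ ∀ m, N ≤ m → 0 < c m ∧ ∀ n, m ≤ n →
      c n / c m ≤ Real.exp ε * ((n : ℝ) / m) ^ (σ + ε) ∧
      c m / c n ≤ Real.exp ε * ((m : ℝ) / n) ^ (σ - ε) := by
  obtain ⟨N, hN1, hN⟩ := h.exists_abs_log_le hc hε
  refine ⟨N, hN1, fun m hm => ⟨(hN m hm).1, fun n hn => ?_⟩⟩
  have hm0 : (0 : ℝ) < m := Nat.cast_pos.2 (by omega)
  have hn0 : (0 : ℝ) < n := Nat.cast_pos.2 (by omega)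
  have hcm := (hN m hm).1
  have hcn := (hN n (by omega)).1
  have h1 := abs_le.1 ((hN m hm).2 n hn)
  rw [Real.rpow_def_of_pos (div_pos hn0 hm0), Real.rpow_def_of_pos (div_pos hm0 hn0),
    ← Real.exp_add, ← Real.exp_add, ← Real.exp_log (div_pos hcn hcm),
    ← Real.exp_log (div_pos hcm hcn), Real.exp_le_exp, Real.exp_le_exp,
    Real.log_div hcn.ne' hcm.ne', Real.log_div hcm.ne' hcn.ne', Real.log_div hn0.ne' hm0.ne',
    Real.log_div hm0.ne' hn0.ne']
  constructor <;> nlinarith [h1.1, h1.2]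

/-- A uniform bound for `c_m / c_N`. -/
theorem RegularlyVaryingSeq.exists_div_le (h : RegularlyVaryingSeq c σ)
    (hc : ∀ n, 0 ≤ c n) (hc1 : ∀ n, c n ≤ 1) (hσ : σ ≤ 0) {ε : ℝ} (hε : 0 < ε) (hε1 : σ + ε ≤ 1) :
    ∃ C, 0 ≤ C ∧ ∀ᶠ N : ℕ in atTop, ∀ m : ℕ,
      c m / c N ≤ C * (((m + 1 : ℝ) / N) ^ (σ - ε) + m / N) := by
  obtain ⟨N₀, hN1, hN⟩ := h.exists_le_rpow hc hε
  have hneg : σ - ε ≤ 0 := by linarith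
  have hc0 := (hN N₀ le_rfl).1
  have h2 : 1 ≤ (2 : ℝ) ^ (ε - σ) := Real.one_le_rpow (by norm_num) (by linarith)
  -- One constant for three ranges: 1/c_{N₀} serves m < N₀, where only c ≤ 1 is known; 2^(ε - σ)
  -- pays for replacing m by m + 1 ≤ 2m when N₀ ≤ m ≤ N; e^ε suffices for m ≥ N. With m + 1 in place
  -- of m, the bound at m = ⌊xN⌋ is controlled by a power of x.
  set C := (c N₀)⁻¹ * (Real.exp ε * 2 ^ (ε - σ)) with hC
  have hcinv : 1 ≤ (c N₀)⁻¹ := (one_le_inv₀ hc0).2 (hc1 _)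
  have hexp := Real.exp_pos ε
  have hC1 : Real.exp ε ≤ C := by
    calc Real.exp ε = 1 * (Real.exp ε * 1) := by ring
      _ ≤ C := by rw [hC]; gcongr
  have hC2 : Real.exp ε * 2 ^ (ε - σ) ≤ C := le_mul_of_one_le_left (by positivity) hcinv
  have hC3 : (c N₀)⁻¹ * Real.exp ε ≤ C := by
    rw [hC]; gcongr; exact le_mul_of_one_le_right hexp.le h2
  have hC0 : 0 ≤ C := hexp.le.trans hC1
  refine ⟨C, hC0, eventually_atTop.2 ⟨N₀, fun N hNN m => ?_⟩⟩
  have hNpos : (0 : ℝ) < N := Nat.cast_pos.2 (by omega)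
  have hr0 : 0 ≤ ((m + 1 : ℝ) / N) ^ (σ - ε) := by positivity
  have hr1 : 0 ≤ (m : ℝ) / N := by positivity
  rw [mul_add]
  rcases lt_or_ge m N₀ with hm | hm
  · refine le_add_of_le_of_nonneg ?_ (mul_nonneg hC0 hr1)
    have h3 := ((hN N₀ le_rfl).2 N hNN).2
    have h4 : ((N₀ : ℝ) / N) ^ (σ - ε) ≤ ((m + 1 : ℝ) / N) ^ (σ - ε) := by
      refine Real.rpow_le_rpow_of_nonpos (by positivity) ?_ hneg
      gcongr
      exact_mod_cast hm
    have hcN := (hN N hNN).1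
    calc c m / c N ≤ 1 / c N := by gcongr; exact hc1 m
      _ = (c N₀)⁻¹ * (c N₀ / c N) := by field_simp
      _ ≤ (c N₀)⁻¹ * (Real.exp ε * ((N₀ : ℝ) / N) ^ (σ - ε)) := by gcongr
      _ ≤ (c N₀)⁻¹ * (Real.exp ε * ((m + 1 : ℝ) / N) ^ (σ - ε)) := by gcongr
      _ = (c N₀)⁻¹ * Real.exp ε * ((m + 1 : ℝ) / N) ^ (σ - ε) := by ring
      _ ≤ _ := by gcongr
  · have hm0 : (1 : ℝ) ≤ m := by exact_mod_cast hN1.trans hm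
    rcases le_total m N with hmN | hmN
    · refine le_add_of_le_of_nonneg ?_ (mul_nonneg hC0 hr1)
      have h3 := ((hN m hm).2 N hmN).2
      have h4 : ((m : ℝ) / N) ^ (σ - ε) ≤ 2 ^ (ε - σ) * ((m + 1 : ℝ) / N) ^ (σ - ε) := by
        have e : (2 : ℝ) ^ (ε - σ) = (1 / 2) ^ (σ - ε) := by
          rw [one_div, Real.inv_rpow (by norm_num), ← Real.rpow_neg (by norm_num), neg_sub]
        rw [e, ← Real.mul_rpow (by norm_num) (by positivity)]
        refine Real.rpow_le_rpow_of_nonpos (by positivity) ?_ hneg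
        rw [← mul_div_assoc]
        gcongr
        linarith
      calc c m / c N ≤ Real.exp ε * ((m : ℝ) / N) ^ (σ - ε) := h3
        _ ≤ Real.exp ε * (2 ^ (ε - σ) * ((m + 1 : ℝ) / N) ^ (σ - ε)) := by gcongr
        _ = Real.exp ε * 2 ^ (ε - σ) * ((m + 1 : ℝ) / N) ^ (σ - ε) := by ring
        _ ≤ _ := by gcongr
    · refine le_add_of_nonneg_of_le (mul_nonneg hC0 hr0) ?_
      have h3 := ((hN N hNN).2 m hmN).1
      have h4 : ((m : ℝ) / N) ^ (σ + ε) ≤ (m : ℝ) / N := by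
        have h5 : 1 ≤ (m : ℝ) / N := by
          rw [one_le_div hNpos]; exact_mod_cast hmN
        calc _ ≤ ((m : ℝ) / N) ^ (1 : ℝ) := Real.rpow_le_rpow_of_exponent_le h5 hε1
          _ = _ := Real.rpow_one _
      exact h3.trans (by gcongr)

end RegVar

/-! ### The Abelian theorem, by comparing sums with integrals -/

open MeasureTheory in
theorem hasSum_setIntegral_floor {f : ℕ → ℝ}
    (hf : IntegrableOn (fun x : ℝ => f ⌊x⌋₊) (Set.Ioi 0)) :
    HasSum f (∫ x in Set.Ioi (0 : ℝ), f ⌊x⌋₊) := by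
  have hU : ⋃ n : ℕ, Set.Ico (n : ℝ) (n + 1) = Set.Ici 0 := by
    ext x
    simp only [Set.mem_iUnion, Set.mem_Ico, Set.mem_Ici]
    exact ⟨fun ⟨n, hn⟩ => (Nat.cast_nonneg n).trans hn.1,
      fun hx => ⟨⌊x⌋₊, Nat.floor_le hx, Nat.lt_floor_add_one x⟩⟩
  have hfl (n : ℕ) (x : ℝ) (hx : x ∈ Set.Ico (n : ℝ) (n + 1)) : ⌊x⌋₊ = n :=
    (Nat.floor_eq_iff ((Nat.cast_nonneg n).trans hx.1)).2 hx
  have hdisj : Pairwise (Function.onFun Disjoint fun n : ℕ => Set.Ico (n : ℝ) (n + 1)) := by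
    intro m n hmn
    refine Set.disjoint_left.2 fun x hm hn => hmn ?_
    rw [← hfl m x hm, hfl n x hn]
  have h := hasSum_integral_iUnion (μ := volume) (f := fun x : ℝ => f ⌊x⌋₊)
    (fun n : ℕ => measurableSet_Ico) hdisj 
    (by rw [hU]; exact (integrableOn_Ici_iff_integrableOn_Ioi).2 hf)
  rw [hU, integral_Ici_eq_integral_Ioi] at h
  refine h.congr_fun fun n => ?_
  rw [setIntegral_congr_fun measurableSet_Ico (g := fun _ => f n)
    (fun x hx => by simp only [hfl n x hx]), setIntegral_const]
  simp

theorem tendsto_one_sub_pow_floor {x : ℝ} (hx : 0 ≤ x) :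
    Tendsto (fun N : ℕ => (1 - 1 / (N : ℝ)) ^ ⌊x * N⌋₊) atTop (𝓝 (Real.exp (-x))) := by
  have h1 := Real.tendsto_one_add_div_pow_exp (-1)
  have h2 := (tendsto_nat_floor_mul_div_atTop (R := ℝ) hx).comp tendsto_natCast_atTop_atTop
  have h3 := h1.rpow h2 (Or.inl (Real.exp_pos _).ne')
  rw [← Real.exp_mul, neg_one_mul] at h3
  refine h3.congr' ?_
  filter_upwards [eventually_ge_atTop 1] with N hN
  have hN' : (1 : ℝ) ≤ N := by exact_mod_cast hN
  have h0 : 0 ≤ 1 + -1 / (N : ℝ) := by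
    rw [neg_div, ← sub_eq_add_neg, sub_nonneg, div_le_one (by positivity)]; exact hN'
  simp only [Function.comp]
  rw [← Real.rpow_natCast_mul h0, mul_div_cancel₀ _ (by positivity), Real.rpow_natCast, neg_div,
    ← sub_eq_add_neg]

theorem one_sub_pow_floor_le (x : ℝ) {N : ℕ} (hN : 1 ≤ N) :
    (1 - 1 / (N : ℝ)) ^ ⌊x * N⌋₊ ≤ Real.exp 1 * Real.exp (-x) := by
  have hN' : (1 : ℝ) ≤ N := by exact_mod_cast hN
  have hN0 : (0 : ℝ) < N := by positivity
  have h0 : 0 ≤ 1 - 1 / (N : ℝ) := by rw [sub_nonneg, div_le_one (by positivity)]; exact hN'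
  calc _ ≤ (Real.exp (-(1 / (N : ℝ)))) ^ ⌊x * N⌋₊ := by
        gcongr
        exact Real.one_sub_le_exp_neg _
    _ = Real.exp (-(⌊x * N⌋₊ / (N : ℝ))) := by
        rw [← Real.exp_nat_mul]; congr 1; ring
    _ ≤ Real.exp (1 - x) := by
        rw [Real.exp_le_exp]
        have h1 : x * N < ⌊x * N⌋₊ + 1 := Nat.lt_floor_add_one _
        have h2 : x ≤ (⌊x * N⌋₊ + 1 : ℝ) / N := by rw [le_div_iff₀ hN0]; exact h1.le
        rw [add_div] at h2
        have h3 : 1 / (N : ℝ) ≤ 1 := (div_le_one hN0).2 hN'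
        linarith
    _ = _ := by rw [← Real.exp_add, sub_eq_add_neg]

open MeasureTheory in
/-- The Abelian theorem for regularly varying sequences. -/
theorem RegularlyVaryingSeq.tendsto_tsum {c : ℕ → ℝ} {ρ : ℝ}
    (h : RegularlyVaryingSeq c (ρ - 1)) (hρ : ρ - 1 ∈ Set.Ioc (-1 : ℝ) 0)
    (hc : ∀ n, 0 ≤ c n) (hc1 : ∀ n, c n ≤ 1) :
    Tendsto (fun N : ℕ => (∑' n, c n * (1 - 1 / (N : ℝ)) ^ n) / (N * c N)) atTop
      (𝓝 (Real.Gamma ρ)) := by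
  have hρ0 : 0 < ρ := by linarith [hρ.1]
  -- With ε = ρ/2 the exponent ρ - 1 - ε = ρ/2 - 1 exceeds -1. The bound is then integrable at 0,
  -- and it consists of the Gamma integrands for ρ/2 and 2.
  obtain ⟨C, hC0, hC⟩ := h.exists_div_le hc hc1 hρ.2 (ε := ρ / 2) (by positivity)
    (by linarith [hρ.2])
  set F : ℕ → ℕ → ℝ := fun N m => c m / c N * (1 - 1 / (N : ℝ)) ^ m with hF
  set bound : ℝ → ℝ := fun x => C * Real.exp 1 *
    (Real.exp (-x) * x ^ (ρ / 2 - 1) + Real.exp (-x) * x ^ ((2 : ℝ) - 1)) with hbound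
  have hbi : IntegrableOn bound (Set.Ioi 0) :=
    ((Real.GammaIntegral_convergent (half_pos hρ0)).add
      (Real.GammaIntegral_convergent two_pos)).const_mul _
  have hmeas (N : ℕ) : Measurable fun x : ℝ => F N ⌊x * N⌋₊ :=
    (measurable_from_top (f := F N)).comp
      (Nat.measurable_floor.comp (measurable_id.mul_const (N : ℝ)))
  have hle : ∀ᶠ N : ℕ in atTop, 1 ≤ N ∧ ∀ x ∈ Set.Ioi (0 : ℝ), ‖F N ⌊x * N⌋₊‖ ≤ bound x := by
    filter_upwards [hC, h.eventually_pos hc, eventually_ge_atTop 1] with N hCN hcN hN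
    refine ⟨hN, fun x hx => ?_⟩
    have hx0 : 0 < x := hx
    have hN' : (1 : ℝ) ≤ N := by exact_mod_cast hN
    have hN0 : (0 : ℝ) < N := by positivity
    have h0 : 0 ≤ 1 - 1 / (N : ℝ) := by rw [sub_nonneg, div_le_one (by positivity)]; exact hN'
    have hnn := hc ⌊x * N⌋₊
    rw [Real.norm_of_nonneg (mul_nonneg (div_nonneg hnn hcN.le) (pow_nonneg h0 _))]
    have h1 : c ⌊x * N⌋₊ / c N ≤ C * (x ^ (ρ / 2 - 1) + x ^ ((2 : ℝ) - 1)) := by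
      refine (hCN _).trans (mul_le_mul_of_nonneg_left (add_le_add ?_ ?_) hC0)
      · rw [show ρ - 1 - ρ / 2 = ρ / 2 - 1 by ring]
        refine Real.rpow_le_rpow_of_nonpos hx0 ?_ (by linarith [hρ.2])
        rw [le_div_iff₀ hN0]
        exact (Nat.lt_floor_add_one _).le
      · rw [show (2 : ℝ) - 1 = 1 by norm_num, Real.rpow_one, div_le_iff₀ hN0]
        exact Nat.floor_le (by positivity)
    calc _ ≤ (C * (x ^ (ρ / 2 - 1) + x ^ ((2 : ℝ) - 1))) * (Real.exp 1 * Real.exp (-x)) :=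
          mul_le_mul h1 (one_sub_pow_floor_le x hN) (pow_nonneg h0 _) (by positivity)
      _ = bound x := by rw [hbound]; ring
  -- After the scaling n = ⌊xN⌋ the sum is an integral whose integrand tends to x^(ρ-1) e^(-x).
  have hlim : Tendsto (fun N : ℕ => ∫ x in Set.Ioi (0 : ℝ), F N ⌊x * N⌋₊) atTop
      (𝓝 (Real.Gamma ρ)) := by
    rw [Real.Gamma_eq_integral hρ0]
    refine tendsto_integral_filter_of_dominated_convergence bound
      (Eventually.of_forall fun N => (hmeas N).aestronglyMeasurable) ?_ hbi ?_
    · filter_upwards [hle] with N hN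
      exact (ae_restrict_iff' measurableSet_Ioi).2 (Eventually.of_forall hN.2)
    · refine (ae_restrict_iff' measurableSet_Ioi).2 (Eventually.of_forall fun x hx => ?_)
      have hx0 : 0 < x := hx
      have h1 := (h x hx0).comp (tendsto_natCast_atTop_atTop (R := ℝ))
      have h2 := h1.mul (tendsto_one_sub_pow_floor hx0.le)
      rw [mul_comm (Real.exp (-x))]
      refine h2.congr fun N => ?_
      simp only [Function.comp, Nat.floor_natCast, hF]
  refine hlim.congr' ?_
  filter_upwards [hle] with N hN
  have hN0 : (0 : ℝ) < N := Nat.cast_pos.2 hN.1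
  have hi : IntegrableOn (fun x : ℝ => F N ⌊x * N⌋₊) (Set.Ioi 0) :=
    hbi.mono' (hmeas N).aestronglyMeasurable
      ((ae_restrict_iff' measurableSet_Ioi).2 (Eventually.of_forall hN.2))
  rw [integrableOn_Ioi_comp_mul_right_iff (fun y : ℝ => F N ⌊y⌋₊) 0 hN0, zero_mul] at hi
  rw [integral_comp_mul_right_Ioi (fun y : ℝ => F N ⌊y⌋₊) 0 hN0, zero_mul,
    ← (hasSum_setIntegral_floor hi).tsum_eq, smul_eq_mul, mul_comm (N : ℝ), ← div_div, div_eq_inv_mul,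
    ← tsum_div_const]
  congr 1
  exact tsum_congr fun n => by simp only [hF]; ring

/-! ### Convergence of polynomials with nonnegative coefficients -/

theorem polynomial_hasSum_eval (P : Polynomial ℝ) (x : ℝ) :
    HasSum (fun j => P.coeff j * x ^ j) (P.eval x) := by
  rw [Polynomial.eval_eq_sum_range]
  refine hasSum_sum_of_ne_finset_zero fun j hj => ?_
  rw [Polynomial.coeff_eq_zero_of_natDegree_lt (by simpa using hj), zero_mul]

/-- Otherwise divide the difference by its lowest power of x and let x tend to 0 along powers of
1/2: the lowest coefficient would be 0. -/
theorem powerSeries_ext_of_hasSum {s t : PowerSeries ℝ} {l : ℝ → ℝ}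
    (hs : ∀ x ∈ Set.Ioo (0 : ℝ) 1, HasSum (fun j => coeff j s * x ^ j) (l x))
    (ht : ∀ x ∈ Set.Ioo (0 : ℝ) 1, HasSum (fun j => coeff j t * x ^ j) (l x)) : s = t := by
  by_contra hne
  have hex : ∃ n, coeff n (s - t) ≠ 0 := by
    by_contra! h
    exact hne (sub_eq_zero.1 (PowerSeries.ext h))
  classical
  set d := Nat.find hex
  have hd0 : coeff d (s - t) ≠ 0 := Nat.find_spec hex
  have hlt (m : ℕ) (hm : m < d) : coeff m (s - t) = 0 := by
    by_contra h
    exact Nat.find_min hex hm h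
  set a : ℕ → ℝ := fun j => coeff (j + d) (s - t) with ha
  have hsum (x : ℝ) (hx : x ∈ Set.Ioo (0 : ℝ) 1) : HasSum (fun j => a j * x ^ j) 0 := by
    have h1 : HasSum (fun j => coeff j (s - t) * x ^ j) 0 := by
      have := (hs x hx).sub (ht x hx)
      rw [sub_self] at this
      exact this.congr_fun fun j => by rw [map_sub, sub_mul]
    have h2 := (hasSum_nat_add_iff' d).2 h1
    rw [Finset.sum_eq_zero fun j hj => by rw [hlt j (Finset.mem_range.1 hj), zero_mul],
      sub_zero] at h2
    have h3 := h2.mul_right ((x ^ d)⁻¹)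
    rw [zero_mul] at h3
    refine h3.congr_fun fun j => ?_
    have := (pow_pos hx.1 d).ne'
    rw [pow_add, mul_assoc, mul_assoc, mul_inv_cancel₀ this, mul_one]
  have hhalf : (1 / 2 : ℝ) ∈ Set.Ioo (0 : ℝ) 1 := by norm_num
  have hlim : Tendsto (fun k : ℕ => ∑' j, a j * ((1 / 2 : ℝ) ^ (k + 1)) ^ j) atTop
      (𝓝 (∑' j, if j = 0 then a 0 else 0)) := by
    refine tendsto_tsum_of_dominated_convergence (hsum _ hhalf).summable.norm (fun j => ?_)
      (Eventually.of_forall fun k j => ?_)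
    · split_ifs with hj
      · simp [hj]
      · have h0 : Tendsto (fun k : ℕ => ((1 / 2 : ℝ) ^ (k + 1)) ^ j) atTop (𝓝 (0 ^ j)) :=
          (((tendsto_pow_atTop_nhds_zero_of_lt_one (by norm_num) (by norm_num)).comp
            (tendsto_add_atTop_nat 1))).pow j
        rw [zero_pow hj] at h0
        simpa using h0.const_mul (a j)
    · rw [norm_mul, norm_mul]
      refine mul_le_mul_of_nonneg_left ?_ (norm_nonneg _)
      rw [Real.norm_of_nonneg (by positivity), Real.norm_of_nonneg (by positivity)]
      exact pow_le_pow_left₀ (by positivity)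
        (pow_le_of_le_one (by norm_num) (by norm_num) (by omega)) j
  rw [tsum_ite_eq] at hlim
  have hz (k : ℕ) : ∑' j, a j * ((1 / 2 : ℝ) ^ (k + 1)) ^ j = 0 :=
    (hsum _ ⟨by positivity, pow_lt_one₀ (by norm_num) (by norm_num) (by omega)⟩).tsum_eq
  simp only [hz] at hlim
  refine hd0 ?_
  have := tendsto_nhds_unique hlim tendsto_const_nhds
  simpa [ha] using this

/-- Polynomials with nonnegative coefficients that converge pointwise on `(0, 1)` converge
coefficientwise, and their limit is the sum of a power series. -/
theorem exists_powerSeries_of_tendsto_eval {a : ℕ → Polynomial ℝ} {l : ℝ → ℝ}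
    (ha : ∀ n j, 0 ≤ (a n).coeff j)
    (h : ∀ x ∈ Set.Ioo (0 : ℝ) 1, Tendsto (fun n => (a n).eval x) atTop (𝓝 (l x))) :
    ∃ L : PowerSeries ℝ, (∀ x ∈ Set.Ioo (0 : ℝ) 1, HasSum (fun j => coeff j L * x ^ j) (l x)) ∧
      ∀ j, Tendsto (fun n => (a n).coeff j) atTop (𝓝 (coeff j L)) := by
  have hle (n j : ℕ) (x : ℝ) (hx : 0 < x) : (a n).coeff j ≤ (a n).eval x / x ^ j := by
    rw [le_div_iff₀ (pow_pos hx j)]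
    exact le_hasSum (polynomial_hasSum_eval (a n) x) j
      fun i _ => mul_nonneg (ha n i) (pow_nonneg hx.le i)
  have hbd (x : ℝ) (hx : x ∈ Set.Ioo (0 : ℝ) 1) :
      ∀ᶠ n in atTop, ∀ j, (a n).coeff j ≤ (l x + 1) / x ^ j := by
    filter_upwards [(h x hx).eventually (gt_mem_nhds (lt_add_one (l x)))] with n hn j
    exact (hle n j x hx.1).trans (div_le_div_of_nonneg_right hn.le (pow_nonneg hx.1.le j))
  -- Compactness: nonnegativity bounds each coefficient by a value of the polynomial, so
  -- coefficients converge along U. Values at some z in (x, 1) give a geometric dominating series,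
  -- so the limiting series sums to l(x). By uniqueness of power series the limit does not depend on
  -- U, hence the whole sequence converges.
  have key (U : Ultrafilter ℕ) (hU : (U : Filter ℕ) ≤ atTop) : ∃ L : PowerSeries ℝ,
      (∀ x ∈ Set.Ioo (0 : ℝ) 1, HasSum (fun j => coeff j L * x ^ j) (l x)) ∧
      ∀ j, Tendsto (fun n => (a n).coeff j) U (𝓝 (coeff j L)) := by
    have hex (j : ℕ) : ∃ y, Tendsto (fun n => (a n).coeff j) U (𝓝 y) := by
      have hK : IsCompact (Set.Icc (0 : ℝ) ((l (1 / 2) + 1) / (1 / 2) ^ j)) := isCompact_Icc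
      have hmem : ∀ᶠ n in (U : Filter ℕ),
          (a n).coeff j ∈ Set.Icc (0 : ℝ) ((l (1 / 2) + 1) / (1 / 2) ^ j) := by
        filter_upwards [hU (hbd (1 / 2) (by norm_num))] with n hn
        exact ⟨ha n j, hn j⟩
      obtain ⟨y, -, hy⟩ := hK.ultrafilter_le_nhds (U.map fun n => (a n).coeff j)
        (le_principal_iff.2 hmem)
      exact ⟨y, hy⟩
    choose y hy using hex
    refine ⟨PowerSeries.mk y, fun x hx => ?_, fun j => by rw [PowerSeries.coeff_mk]; exact hy j⟩
    simp only [PowerSeries.coeff_mk]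
    obtain ⟨z, hz1, hz2⟩ := exists_between hx.2
    have hz : z ∈ Set.Ioo (0 : ℝ) 1 := ⟨hx.1.trans hz1, hz2⟩
    have hxz : x / z < 1 := (div_lt_one hz.1).2 hz1
    have hx0 := hx.1
    have hz0 := hz.1
    have hsb : Summable fun j : ℕ => (l z + 1) * (x / z) ^ j :=
      (summable_geometric_of_lt_one (by positivity) hxz).mul_left _
    have hbz : ∀ᶠ n in (U : Filter ℕ), ∀ j, ‖(a n).coeff j * x ^ j‖ ≤ (l z + 1) * (x / z) ^ j := by
      filter_upwards [hU (hbd z hz)] with n hn j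
      rw [Real.norm_of_nonneg (mul_nonneg (ha n j) (by positivity)), div_pow, ← mul_div_assoc,
        mul_div_right_comm]
      exact mul_le_mul_of_nonneg_right (hn j) (by positivity)
    have hlim := tendsto_tsum_of_dominated_convergence (𝓕 := (U : Filter ℕ)) hsb
      (fun j => (hy j).mul_const (x ^ j)) hbz
    simp only [(polynomial_hasSum_eval _ x).tsum_eq] at hlim
    have hs : Summable fun j => y j * x ^ j := by
      refine Summable.of_norm_bounded hsb fun j => ?_
      exact le_of_tendsto ((hy j).mul_const (x ^ j)).norm (hbz.mono fun n hn => hn j)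
    rw [tendsto_nhds_unique ((h x hx).mono_left hU) hlim]
    exact hs.hasSum
  obtain ⟨L, hL, -⟩ := key (Ultrafilter.of atTop) (Ultrafilter.of_le atTop)
  refine ⟨L, hL, fun j => tendsto_iff_ultrafilter _ _ _ |>.2 fun U hU => ?_⟩
  obtain ⟨L', hL', hj⟩ := key U hU
  rw [powerSeries_ext_of_hasSum hL hL']
  exact hj j

theorem convergesLiminf_of_tendsto {a : ℕ → Polynomial ℝ} {L : PowerSeries ℝ} {A : Set ℝ}
    (h : ∀ q ∈ A, Tendsto (fun n => (a n).eval q) atTop (𝓝 (psEval L q))) :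
    ConvergesLiminf a L A := fun q hq =>
  ((continuous_coe_real_ereal.tendsto _).comp (h q hq)).liminf_eq

theorem convergesOffDensityZero_of_tendsto {a : ℕ → Polynomial ℝ} {L : PowerSeries ℝ} {A : Set ℝ}
    (h : ∀ q ∈ A, Tendsto (fun n => (a n).eval q) atTop (𝓝 (psEval L q))) :
    ConvergesOffDensityZero a L A := by
  classical
  intro δ hδ q hq
  set f : ℕ → ℝ := fun i => if δ ≤ |(a i).eval q - psEval L q| then (1 : ℝ) else 0 with hf
  -- The indicator is eventually 0, so its Cesàro means tend to 0; the shift matches averages over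
  -- 1, …, n.
  have hf0 : Tendsto (fun n => f (n + 1)) atTop (𝓝 0) := by
    refine (tendsto_add_atTop_iff_nat 1).2 ?_
    refine tendsto_const_nhds.congr' ?_
    filter_upwards [(Metric.tendsto_nhds.1 (h q hq)) δ hδ] with n hn
    rw [Real.dist_eq] at hn
    rw [hf]
    simp only [if_neg (not_le.2 hn)]
  refine hf0.cesaro.congr fun n => ?_
  rw [one_div]
  congr 1
  have e : Finset.Icc 1 n = Finset.Ico (0 + 1) (n + 1) := by ext; simp
  rw [e, ← Finset.sum_Ico_add' _ 0 n 1, ← Finset.range_eq_Ico]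

/-! ### The regularly varying case -/

theorem isProbSeries_rescale {φ : PowerSeries ℝ} {ζ : ℝ} (hφ : constantCoeff φ = 0)
    (hζ : 0 < ζ) (h0 : ∀ n, 0 ≤ coeff n φ) (h1 : HasSum (fun n => coeff n φ * ζ ^ n) 1) :
    IsProbSeries (rescale ζ φ) where
  constantCoeff_eq := by
    rw [← PowerSeries.coeff_zero_eq_constantCoeff_apply, PowerSeries.coeff_rescale,
      PowerSeries.coeff_zero_eq_constantCoeff_apply, hφ, mul_zero]
  nonneg n := by rw [PowerSeries.coeff_rescale]; exact mul_nonneg (by positivity) (h0 n)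
  hasSum := h1.congr_fun fun n => by rw [PowerSeries.coeff_rescale, mul_comm]

theorem regVarConclusion_of_assumptions {φ : PowerSeries ℝ} (hφ : constantCoeff φ = 0)
    {g : ℝ → PowerSeries ℝ}
    (hg : ∀ q ∈ Set.Ioo (0 : ℝ) 1, IsRightInverse q (PowerSeries.X * (1 - φ)) (g q))
    {ζ ρ : ℝ} (h : RegVarAssumptions φ ζ ρ) :
    RegVarConclusion φ ζ ρ fun q n => coeff n (g q) := by
  have hφn (n : ℕ) : 0 ≤ coeff n φ := by
    rcases Nat.eq_zero_or_pos n with rfl | hn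
    · rw [PowerSeries.coeff_zero_eq_constantCoeff_apply, hφ]
    · exact h.nonneg n hn
  obtain ⟨hζ, hζ1⟩ := h.zeta_isLeast.1
  have hp := isProbSeries_rescale hφ hζ hφn hζ1
  set c : ℕ → ℝ := fun n => coeff n (1 - rescale ζ φ)⁻¹ with hc
  have hc0 (n : ℕ) : 0 ≤ c n := (hp.coeff_inv_mem n).1
  have hc1 (n : ℕ) : c n ≤ 1 := (hp.coeff_inv_mem n).2
  have hrv : RegularlyVaryingSeq c (ρ - 1) := h.regVar
  have hpos := hrv.eventually_pos hc0
  have hratio := hrv.tendsto_div_succ hc0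
  have hρ : 0 < ρ := by linarith [h.rho_mem.1]
  have hΓ := Real.Gamma_pos_of_pos hρ
  set d : ℕ → ℝ := fun n => ζ ^ n * n * (1 - psEval φ (ζ * (1 - 1 / (n : ℝ)))) with hd
  have hx (n : ℕ) (hn : 1 ≤ n) : 0 ≤ 1 - 1 / (n : ℝ) ∧ 1 - 1 / (n : ℝ) < 1 := by
    have hn' : (1 : ℝ) ≤ n := by exact_mod_cast hn
    constructor
    · rw [sub_nonneg, div_le_one (by positivity)]; exact hn'
    · have : 0 < 1 / (n : ℝ) := by positivity
      linarith
  have hd0 (n : ℕ) (hn : 1 ≤ n) : 0 ≤ d n := by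
    have h1 := (hp.psEval_le (hx n hn).1 (hx n hn).2).2
    rw [psEval_rescale] at h1
    have h2 := (hx n hn).2
    exact mul_nonneg (by positivity) (by linarith)
  have hnn (n : ℕ) := isNonnegPoly_coeff hφ hφn hg n
  choose P hP0 hP using hnn
  set a : ℕ → Polynomial ℝ := fun n => if n = 0 then 0 else Polynomial.C (d n) * P n with ha
  have haeval (n : ℕ) (hn : 1 ≤ n) (q : ℝ) (hq : q ∈ Set.Ioo (0 : ℝ) 1) :
      (a n).eval q = d n * q ^ (n.choose 2) * coeff n (g q) := by
    simp only [ha, if_neg (show n ≠ 0 by omega)]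
    rw [Polynomial.eval_mul, Polynomial.eval_C, hP n q hq]
    exact (mul_assoc _ _ _).symm
  have ha0 (n j : ℕ) : 0 ≤ (a n).coeff j := by
    simp only [ha]
    split_ifs with hn
    · simp
    · rw [Polynomial.coeff_C_mul]
      exact mul_nonneg (hd0 n (by omega)) (hP0 n j)
  -- The Abelian theorem inverted: its sum is the generating function of c at 1 - 1/n, equal to 1/(1
  -- - φ(ζ(1 - 1/n))).
  have hdc : Tendsto (fun n : ℕ => n * (1 - psEval φ (ζ * (1 - 1 / (n : ℝ)))) * c n) atTop
      (𝓝 (Real.Gamma ρ)⁻¹) := by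
    refine ((hrv.tendsto_tsum h.rho_mem hc0 hc1).inv₀ hΓ.ne').congr' ?_
    filter_upwards [eventually_ge_atTop 1] with n hn
    rw [(hp.hasSum_inv (hx n hn).1 (hx n hn).2).tsum_eq, psEval_rescale, inv_div, div_inv_eq_mul]
    ring
  have hlim (q : ℝ) (hq : q ∈ Set.Ioo (0 : ℝ) 1) : Tendsto (fun n => (a n).eval q) atTop
      (𝓝 (ζ / (Real.Gamma ρ * ∏' j : ℕ, (1 - psEval φ (ζ * q ^ (j + 1)))))) := by
    have hgn (n : ℕ) : 0 ≤ coeff n (g q) := by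
      have h1 := (show IsNonnegPoly fun q => q ^ (n.choose 2) * coeff n (g q) from
        ⟨P n, hP0 n, hP n⟩).nonneg hq
      exact nonneg_of_mul_nonneg_right h1 (pow_pos hq.1 _)
    obtain ⟨-, -, h1⟩ := (hg q hq).tendsto_div hq hζ hφ hp hgn hpos hratio
    -- The asymptotics of g_{n+1} are relative to c_n and the normalization of a_{n+1} to c_{n+1};
    -- the ratio c_n/c_{n+1} links them.
    have h2 := ((((tendsto_add_atTop_iff_nat 1).2 hdc).mul hratio).mul h1).const_mul ζ
    rw [← tendsto_add_atTop_iff_nat 1, div_eq_mul_inv, mul_inv]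
    rw [mul_one] at h2
    refine h2.congr' ?_
    filter_upwards [hpos, (tendsto_add_atTop_nat 1).eventually hpos] with n hn hn1
    rw [haeval (n + 1) (by omega) q hq]
    simp only [hd, hc] at hn hn1 ⊢
    rw [pow_succ]
    field_simp
  obtain ⟨L, hL, hLc⟩ := exists_powerSeries_of_tendsto_eval ha0 hlim
  have hlim' : ∀ q ∈ Set.Ioo (0 : ℝ) 1, Tendsto (fun n => (a n).eval q) atTop
      (𝓝 (psEval L q)) := fun q hq => by
    rw [psEval, (hL q hq).tsum_eq]; exact hlim q hq
  refine ⟨a, L, fun n hn q hq => haeval n hn q hq, fun q hq => ⟨?_, hL q hq⟩,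
    convergesLiminf_of_tendsto hlim', convergesOffDensityZero_of_tendsto hlim', hLc⟩
  have hgn (n : ℕ) : 0 ≤ coeff n (g q) := by
    have h1 := (show IsNonnegPoly fun q => q ^ (n.choose 2) * coeff n (g q) from
      ⟨P n, hP0 n, hP n⟩).nonneg hq
    exact nonneg_of_mul_nonneg_right h1 (pow_pos hq.1 _)
  exact ((hg q hq).tendsto_div hq hζ hφ hp hgn hpos hratio).1

/-! ### The renewal theorem for entire generating functions -/

section Renewal

variable {p : PowerSeries ℝ}

theorem differentiable_tsum_coeff (hs : ∀ R : ℝ, Summable fun n => coeff n p * R ^ n) :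
    Differentiable ℂ fun z : ℂ => ∑' n, ((coeff n p : ℝ) : ℂ) * z ^ n := by
  intro z
  have h := Complex.differentiableOn_tsum_of_summable_norm
    (F := fun n (z : ℂ) => ((coeff n p : ℝ) : ℂ) * z ^ n) (U := Metric.ball 0 (‖z‖ + 1))
    (hs (‖z‖ + 1)).norm (fun n => by fun_prop) Metric.isOpen_ball (fun n w hw => by
      rw [mem_ball_zero_iff] at hw
      rw [norm_mul, norm_mul, norm_pow, norm_pow, Complex.norm_real]
      refine mul_le_mul_of_nonneg_left ?_ (norm_nonneg _)
      exact pow_le_pow_left₀ (norm_nonneg _) (hw.le.trans (le_abs_self _)) n)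
  exact h.differentiableAt (Metric.isOpen_ball.mem_nhds (by simp))

theorem tsum_coeff_ofReal (x : ℝ) :
    ∑' n, ((coeff n p : ℝ) : ℂ) * (x : ℂ) ^ n = (psEval p x : ℝ) := by
  rw [psEval, Complex.ofReal_tsum]
  exact tsum_congr fun n => by push_cast; rfl

theorem deriv_tsum_coeff_ofReal (hs : ∀ R : ℝ, Summable fun n => coeff n p * R ^ n) (x : ℝ) :
    ∃ m : ℝ, deriv (fun z : ℂ => ∑' n, ((coeff n p : ℝ) : ℂ) * z ^ n) x = m ∧
      HasDerivAt (psEval p) m x := by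
  have hd := (differentiable_tsum_coeff hs (x : ℂ)).hasDerivAt
  set m := deriv (fun z : ℂ => ∑' n, ((coeff n p : ℝ) : ℂ) * z ^ n) x with hm
  have hre := hd.real_of_complex
  -- Multiplication by -i turns the imaginary part, which vanishes on the real axis, into the real
  -- part; so the derivative is real.
  have him := (hd.const_mul (-Complex.I)).real_of_complex
  simp only [tsum_coeff_ofReal, Complex.ofReal_re] at hre him
  have h0 : (-Complex.I * m).re = 0 := by
    refine him.unique ?_
    simpa using hasDerivAt_const x (0 : ℝ)
  refine ⟨m.re, Complex.ext rfl ?_, hre⟩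
  simpa using h0

/-- As p(x) ≤ x on [0, 1) and p(1) = 1, all chords ending at 1 have slope at least 1. -/
theorem IsProbSeries.one_le_of_hasDerivAt (hp : IsProbSeries p) {m : ℝ}
    (h : HasDerivAt (psEval p) m 1) : 1 ≤ m := by
  have h1 := (hasDerivAt_iff_tendsto_slope.1 h).mono_left
    (nhdsWithin_mono (1 : ℝ) (show Set.Iio (1 : ℝ) ⊆ {1}ᶜ from fun x hx => ne_of_lt hx))
  refine ge_of_tendsto h1 ?_
  filter_upwards [Ioo_mem_nhdsLT (zero_lt_one' ℝ)] with x hx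
  have hx1 : psEval p 1 = 1 := by simpa [psEval] using hp.hasSum.tsum_eq
  have h2 := (hp.psEval_le hx.1.le hx.2).2
  rw [slope_def_field, hx1, ← neg_sub 1 x, ← neg_sub 1 (psEval p x), neg_div_neg_eq,
    le_div_iff₀ (sub_pos.2 hx.2)]
  linarith

theorem coeff_eq_sum_range (C : PowerSeries ℝ) (n : ℕ) :
    ∑ i ∈ Finset.range (n + 1), coeff i ((1 - PowerSeries.X) * C) = coeff n C := by
  induction n with
  | zero => simp
  | succ n ih =>
    rw [Finset.sum_range_succ, ih, sub_mul, one_mul, map_sub, PowerSeries.coeff_succ_X_mul]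
    ring

/-- The renewal theorem for an entire generating function that takes the value `1` in the closed
unit disk only at `1`. -/
theorem IsProbSeries.tendsto_coeff_inv (hp : IsProbSeries p)
    (hs : ∀ R : ℝ, Summable fun n => coeff n p * R ^ n)
    (hne : ∀ z : ℂ, ‖z‖ ≤ 1 → z ≠ 1 → ∑' n, ((coeff n p : ℝ) : ℂ) * z ^ n ≠ 1) :
    ∃ m : ℝ, 1 ≤ m ∧ HasDerivAt (psEval p) m 1 ∧
      Tendsto (fun n => coeff n (1 - p)⁻¹) atTop (𝓝 m⁻¹) := by
  obtain ⟨m, hm, hder⟩ := deriv_tsum_coeff_ofReal hs 1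
  have hm1 := hp.one_le_of_hasDerivAt hder
  refine ⟨m, hm1, hder, ?_⟩
  set P : ℂ → ℂ := fun z => ∑' n, ((coeff n p : ℝ) : ℂ) * z ^ n with hP
  have hPr (x : ℝ) : P x = (psEval p x : ℝ) := tsum_coeff_ofReal x
  have hP1 : P 1 = 1 := by
    have h1 : psEval p 1 = 1 := by simpa [psEval] using hp.hasSum.tsum_eq
    have := hPr 1
    rwa [h1, Complex.ofReal_one] at this
  rw [Complex.ofReal_one] at hm
  -- The divided difference (1 - P(z))/(1 - z) is entire, with value m at 1.
  have hDd : Differentiable ℂ (dslope P 1) := by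
    rw [← differentiableOn_univ, Complex.differentiableOn_dslope univ_mem, differentiableOn_univ]
    exact differentiable_tsum_coeff hs
  have hD1 : dslope P 1 1 = m := by rw [dslope_same, hm]
  have hDne (z : ℂ) (hz : z ≠ 1) : dslope P 1 z = (1 - P z) / (1 - z) := by
    rw [dslope_of_ne _ hz, slope_def_field, hP1, ← neg_sub 1 z, ← neg_sub 1 (P z), neg_div_neg_eq]
  have hD0 : Metric.closedBall (0 : ℂ) 1 ⊆ {z | dslope P 1 z ≠ 0} := by
    intro z hz
    rw [mem_closedBall_zero_iff] at hz
    rcases eq_or_ne z 1 with rfl | hz1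
    · rw [Set.mem_ofPred_eq, hD1, Complex.ofReal_ne_zero]
      linarith
    · rw [Set.mem_ofPred_eq, hDne z hz1]
      exact div_ne_zero (sub_ne_zero.2 (hne z hz hz1).symm) (sub_ne_zero.2 hz1.symm)
  -- By compactness it has no zero in a disk of radius 1 + δ, so the Taylor series of its reciprocal
  -- converges at z = 1.
  obtain ⟨δ, hδ, hsub⟩ := (isCompact_closedBall (0 : ℂ) 1).exists_cthickening_subset_open
    (isOpen_ne_fun hDd.continuous continuous_const) hD0
  rw [cthickening_closedBall hδ.le zero_le_one] at hsub
  set F : ℂ → ℂ := fun z => (dslope P 1 z)⁻¹ with hF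
  have hFd : DifferentiableOn ℂ F (Metric.ball 0 (δ + 1)) :=
    hDd.differentiableOn.inv fun z hz => hsub (Metric.ball_subset_closedBall hz)
  set e : ℕ → ℝ := fun n => (((n.factorial : ℂ))⁻¹ * iteratedDeriv n F 0).re with he
  have hsum (x : ℝ) (h0 : 0 ≤ x) (h1 : x ≤ 1) : HasSum (fun n => e n * x ^ n) (F x).re := by
    have h := Complex.hasSum_taylorSeries_on_ball hFd (z := (x : ℂ)) (by
      rw [mem_ball_zero_iff, Complex.norm_real, Real.norm_of_nonneg h0]; linarith)
    refine (Complex.hasSum_re h).congr_fun fun n => ?_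
    rw [he, sub_zero, smul_eq_mul, smul_eq_mul, ← Complex.ofReal_pow, mul_left_comm,
      Complex.re_ofReal_mul, mul_comm]
  have hE : PowerSeries.mk e = (1 - PowerSeries.X) * (1 - p)⁻¹ := by
    refine powerSeries_ext_of_hasSum (l := fun x => (F x).re) (fun x hx => ?_) fun x hx => ?_
    · simpa only [PowerSeries.coeff_mk] using hsum x hx.1.le hx.2.le
    · have h1 := polynomial_hasSum_eval (1 - Polynomial.X) x
      have h2 : HasSum (fun n => coeff n (1 - PowerSeries.X : PowerSeries ℝ) * x ^ n) (1 - x) := by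
        simp only [Polynomial.eval_sub, Polynomial.eval_one, Polynomial.eval_X] at h1
        refine h1.congr_fun fun n => ?_
        rw [← Polynomial.coeff_coe]
        simp
      have h3 := hasSum_mul h2 (hp.hasSum_inv hx.1.le hx.2)
      have h4 : (F x).re = (1 - x) * (1 - psEval p x)⁻¹ := by
        have hx1 : (x : ℂ) ≠ 1 := by
          rw [Ne, Complex.ofReal_eq_one]; exact hx.2.ne
        simp only [hF]
        rw [hDne _ hx1, hPr, inv_div, ← Complex.ofReal_one, ← Complex.ofReal_sub,
          ← Complex.ofReal_sub, ← Complex.ofReal_div, Complex.ofReal_re, div_eq_mul_inv]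
      simp only [h4]
      exact h3
  -- At 1 the coefficients of (1 - z)/(1 - p(z)) sum to 1/m, and their partial sums are the renewal
  -- sequence.
  have hfin := hsum 1 zero_le_one le_rfl
  have hF1 : (F (1 : ℝ)).re = m⁻¹ := by
    simp only [hF]
    rw [Complex.ofReal_one, hD1, ← Complex.ofReal_inv, Complex.ofReal_re]
  rw [hF1] at hfin
  simp only [one_pow, mul_one] at hfin
  refine (hfin.tendsto_sum_nat.comp (tendsto_add_atTop_nat 1)).congr fun n => ?_
  rw [← coeff_eq_sum_range (1 - p)⁻¹ n, ← hE]
  simp only [Function.comp, PowerSeries.coeff_mk]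

end Renewal

/-! ### The case of superexponentially small coefficients -/

theorem superexpConclusion_of_assumptions {φ : PowerSeries ℝ} (hφ : constantCoeff φ = 0)
    {q : ℝ} (hq : q ∈ Set.Ioo (0 : ℝ) 1) {g : PowerSeries ℝ}
    (hg : IsRightInverse q (PowerSeries.X * (1 - φ)) g) (hgn : ∀ n, 0 ≤ coeff n g)
    {ζ : ℝ} {θ : ℂ → ℂ} (h : SuperexpAssumptions φ ζ θ) :
    SuperexpConclusion φ ζ θ q fun n => coeff n g := by
  have hζ := h.zeta_pos
  have hζc : (ζ : ℂ) ≠ 0 := Complex.ofReal_ne_zero.2 hζ.ne'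
  have hreal (x : ℝ) : HasSum (fun n => coeff n φ * x ^ n) (psEval φ x) ∧
      ((psEval φ x : ℝ) : ℂ) = 1 - (1 - (x : ℂ) / ζ) * θ x := by
    have h1 := h.factor x
    have h2 : Summable fun n => coeff n φ * x ^ n := by
      refine Complex.summable_ofReal.1 (h1.summable.congr fun n => ?_)
      push_cast; rfl
    exact ⟨h2.hasSum, by rw [← tsum_coeff_ofReal, h1.tsum_eq]⟩
  have hζ1 : HasSum (fun n => coeff n φ * ζ ^ n) 1 := by
    have h1 := (hreal ζ).2
    rw [div_self hζc, sub_self, zero_mul, sub_zero, Complex.ofReal_eq_one] at h1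
    exact h1 ▸ (hreal ζ).1
  have hp := isProbSeries_rescale hφ hζ h.nonneg hζ1
  have hs (R : ℝ) : Summable fun n => coeff n (rescale ζ φ) * R ^ n := by
    refine (hreal (ζ * R)).1.summable.congr fun n => ?_
    rw [PowerSeries.coeff_rescale, mul_pow]; ring
  -- This is where the absence of zeros of θ enters: 1 - φ(ζz) = (1 - z) θ(ζz) vanishes in the
  -- closed unit disk only at 1.
  have hne (z : ℂ) (hz : ‖z‖ ≤ 1) (hz1 : z ≠ 1) :
      ∑' n, ((coeff n (rescale ζ φ) : ℝ) : ℂ) * z ^ n ≠ 1 := by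
    have h1 := (h.factor (ζ * z)).tsum_eq
    have h2 : ∑' n, ((coeff n (rescale ζ φ) : ℝ) : ℂ) * z ^ n = 1 - (1 - z) * θ (ζ * z) := by
      rw [mul_div_cancel_left₀ z hζc] at h1
      rw [← h1]
      refine tsum_congr fun n => ?_
      rw [PowerSeries.coeff_rescale]
      push_cast
      rw [mul_pow]; ring
    rw [h2, Ne, sub_eq_self]
    refine mul_ne_zero (sub_ne_zero.2 hz1.symm) (h.no_root _ ?_)
    rw [norm_mul, Complex.norm_real, Real.norm_of_nonneg hζ.le]
    exact mul_le_of_le_one_right hζ.le hz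
  obtain ⟨m, hm1, hder, hc⟩ := hp.tendsto_coeff_inv hs hne
  have hm0 : 0 < m := one_pos.trans_le hm1
  have hminv : 0 < m⁻¹ := inv_pos.2 hm0
  have hpos := hc.eventually (lt_mem_nhds hminv)
  have hratio := hc.div ((tendsto_add_atTop_iff_nat 1).2 hc) hminv.ne'
  rw [div_self hminv.ne'] at hratio
  obtain ⟨hmul, hPpos, hlim⟩ := hg.tendsto_div hq hζ hφ hp hgn hpos hratio
  have hderiv : deriv (psEval φ) ζ = m / ζ := by
    have h1 : HasDerivAt (fun y : ℝ => y / ζ) (1 / ζ) ζ := (hasDerivAt_id ζ).div_const ζ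
    have h2 : HasDerivAt (fun y => psEval (rescale ζ φ) (y / ζ)) (m * (1 / ζ)) ζ :=
      HasDerivAt.comp (h₂ := psEval (rescale ζ φ)) (h := fun y => y / ζ) ζ
        (by simpa only [div_self hζ.ne'] using hder) h1
    have h3 : (fun y => psEval (rescale ζ φ) (y / ζ)) = psEval φ := by
      funext y
      rw [psEval_rescale, mul_div_cancel₀ _ hζ.ne']
    rw [h3] at h2
    rw [h2.deriv, mul_one_div]
  have hqj (j : ℕ) : 0 < q ^ (j + 1) ∧ q ^ (j + 1) ≤ q :=
    ⟨pow_pos hq.1 _, pow_le_of_le_one hq.1.le hq.2.le (by omega)⟩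
  have hqs : Summable fun j : ℕ => q ^ (j + 1) :=
    (summable_nat_add_iff 1).2 (summable_geometric_of_lt_one hq.1.le hq.2)
  have hm1 : Multipliable fun j : ℕ => 1 - q ^ (j + 1) := by
    simpa only [sub_eq_add_neg] using
      multipliable_one_add_of_summable (f := fun j : ℕ => -q ^ (j + 1)) (by
        simpa only [norm_neg] using hqs.norm)
  -- These are the values θ(ζ q^(j+1)), seen to be real; they split the product of 1 - φ(ζ q^j) into
  -- the two products of the statement.
  set t : ℕ → ℝ := fun j => (1 - psEval φ (ζ * q ^ (j + 1))) / (1 - q ^ (j + 1)) with ht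
  have htθ (j : ℕ) : θ ((ζ * q ^ (j + 1) : ℝ) : ℂ) = (t j : ℝ) := by
    have h1 := (hreal (ζ * q ^ (j + 1))).2
    have h2 : (1 - (q : ℂ) ^ (j + 1)) ≠ 0 := by
      have : (1 : ℝ) - q ^ (j + 1) ≠ 0 := by
        have := (hqj j).2.trans_lt hq.2
        linarith
      exact_mod_cast this
    simp only [ht, Complex.ofReal_div, Complex.ofReal_sub, Complex.ofReal_one, h1]
    rw [sub_sub_cancel, Complex.ofReal_mul, mul_div_cancel_left₀ _ hζc, Complex.ofReal_pow,
      mul_div_cancel_left₀ _ h2]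
  have hm2 : Multipliable t := by
    have h1 : Summable fun j : ℕ => ‖t j - 1‖ := by
      refine Summable.of_nonneg_of_le (fun _ => norm_nonneg _) (fun j => ?_)
        (hqs.mul_left (1 - q)⁻¹)
      have hq1 : 0 < 1 - q := sub_pos.2 hq.2
      have hq2 : 1 - q ≤ 1 - q ^ (j + 1) := by linarith [(hqj j).2]
      have h2 := hp.psEval_le (hqj j).1.le ((hqj j).2.trans_lt hq.2)
      rw [psEval_rescale] at h2
      have h3 : t j - 1 = (q ^ (j + 1) - psEval φ (ζ * q ^ (j + 1))) / (1 - q ^ (j + 1)) := by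
        rw [ht]
        have : 1 - q ^ (j + 1) ≠ 0 := (hq1.trans_le hq2).ne'
        field_simp
        ring
      rw [h3, norm_div, Real.norm_of_nonneg (hq1.le.trans hq2), Real.norm_of_nonneg (by linarith),
        ← div_eq_inv_mul]
      exact div_le_div₀ (hqj j).1.le (by linarith) hq1 hq2
    simpa only [add_sub_cancel] using multipliable_one_add_of_summable h1
  have hprod : ∏' j : ℕ, (1 - psEval φ (ζ * q ^ (j + 1))) =
      (∏' j : ℕ, (1 - q ^ (j + 1))) * ∏' j, t j := by
    rw [← hm1.tprod_mul hm2]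
    refine tprod_congr fun j => ?_
    have : 1 - q ^ (j + 1) ≠ 0 := by
      have := (hqj j).2.trans_lt hq.2
      linarith
    rw [ht, mul_div_cancel₀ _ this]
  have hθ : HasProd (fun j : ℕ => θ ((ζ * q ^ (j + 1) : ℝ) : ℂ)) ((∏' j, t j : ℝ) : ℂ) := by
    simp only [htθ]
    exact hm2.hasProd.map Complex.ofRealHom Complex.continuous_ofReal
  refine ⟨hm1, hθ.multipliable, isEquivalent_of_tendsto_one ?_⟩
  rw [hθ.tprod_eq, hderiv]
  have hfin := (hlim.mul hc).mul_const
    (m * ∏' j : ℕ, (1 - psEval φ (ζ * q ^ (j + 1))))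
  have hone : (∏' j : ℕ, (1 - psEval φ (ζ * q ^ (j + 1))))⁻¹ * m⁻¹ *
      (m * ∏' j : ℕ, (1 - psEval φ (ζ * q ^ (j + 1)))) = 1 := by
    have := hPpos.ne'
    field_simp
  rw [hone] at hfin
  rw [← tendsto_add_atTop_iff_nat 1]
  have hfin' := (Complex.continuous_ofReal.tendsto 1).comp hfin
  rw [Complex.ofReal_one] at hfin'
  refine hfin'.congr' ?_
  filter_upwards [hpos] with n hn
  simp only [Function.comp, Pi.div_apply]
  rw [div_div_eq_mul_div, div_one, ← Complex.ofReal_mul, ← Complex.ofReal_mul, Complex.ofReal_inj,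
    hprod, pow_succ]
  field_simp

end QLagrange

/-! ### The theorem, applied to φ(-z) and -g(-z) -/

/-- `φ` has no constant term, `f(z) = z (1 - φ(z))`, and for `0 < q < 1` the series `g q` is the
right inverse of `f`. The series `rescale (-1) φ` is `φ(-z)`. -/
theorem theorem2p7 (φ : PowerSeries ℝ) (hφ : constantCoeff φ = 0)
    (g : ℝ → PowerSeries ℝ)
    (hg : ∀ q ∈ Set.Ioo (0 : ℝ) 1,
      QLagrange.IsRightInverse q (PowerSeries.X * (1 - φ)) (g q)) :
    (∀ ζ ρ : ℝ, QLagrange.RegVarAssumptions (rescale (-1 : ℝ) φ) ζ ρ →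
      QLagrange.RegVarConclusion (rescale (-1 : ℝ) φ) ζ ρ
        (fun q n => (-1) ^ (n + 1) * coeff n (g q))) ∧
    (∀ (ζ : ℝ) (θ : ℂ → ℂ), QLagrange.SuperexpAssumptions (rescale (-1 : ℝ) φ) ζ θ →
      ∀ q ∈ Set.Ioo (0 : ℝ) 1,
        QLagrange.SuperexpConclusion (rescale (-1 : ℝ) φ) ζ θ q
          (fun n => (-1) ^ (n + 1) * coeff n (g q))) := by
  have hφ' : constantCoeff (rescale (-1 : ℝ) φ) = 0 := by
    rw [← PowerSeries.coeff_zero_eq_constantCoeff_apply, PowerSeries.coeff_rescale,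
      PowerSeries.coeff_zero_eq_constantCoeff_apply, hφ, mul_zero]
  have hg' : ∀ q ∈ Set.Ioo (0 : ℝ) 1, QLagrange.IsRightInverse q
      (PowerSeries.X * (1 - rescale (-1 : ℝ) φ)) (-(rescale (-1 : ℝ) (g q))) :=
    fun q hq => (hg q hq).neg
  have hcoeff (q : ℝ) (n : ℕ) :
      (-1) ^ (n + 1) * coeff n (g q) = coeff n (-(rescale (-1 : ℝ) (g q))) := by
    rw [map_neg, PowerSeries.coeff_rescale, pow_succ]
    ring
  simp only [hcoeff]
  refine ⟨fun ζ ρ h => QLagrange.regVarConclusion_of_assumptions hφ' hg' h,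
    fun ζ θ h q hq => QLagrange.superexpConclusion_of_assumptions hφ' hq (hg' q hq) ?_ h⟩
  intro n
  exact nonneg_of_mul_nonneg_right
    ((QLagrange.isNonnegPoly_coeff hφ' h.nonneg hg' n).nonneg hq) (pow_pos hq.1 _)
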